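/- Theorem ($\mathrm{QVNE}\in\mathrm{P}$). In no-budget multiple-issue quadratic voting, a finite society $N$ chooses from a finite set of outcomes $\Omega$. Agent $i$ has utility $u^i_\omega$ for outcome $\omega$, and its strategy is a vector $v^i\in\mathbb{Z}^{\Omega}$ of (possibly negative) numbers of votes. Let $W=\arg\max_{\omega}\sum_{i\in N}v^i_\omega$ be the set of outcomes with the highest total number of votes; the winner is drawn uniformly at random from $W$. With a price constant $\alpha>0$, the utility of agent $i$ under the strategy profile $v$ is $$U^i(v)=\frac1{|W|}\sum_{\omega\in W}u^i_\omega-\alpha\sum_{\omega\in\Omega}(v^i_\omega)^2+\frac{\alpha}{|N|-1}\sum_{j\ne i}\sum_{\omega\in\Omega}(v^j_\omega)^2$$ (the first term is $0$ if $\Omega=\emptyset$, and the last term is $0$ if $|N|=1$). The profile $v$ is a pure Nash equilibrium if $U^i(v)\ge U^i(v^{-i},\sigma)$ for all $i\in N$ and all $\sigma\in\mathbb{Z}^{\Omega}$. For every fixed rational $\alpha>0$, the language $$\mathrm{QVNE}=\{\langle N,\Omega,u,v\rangle \mid u\in\mathbb{Z}^{N\times\Omega},\ v\in\mathbb{Z}^{N\times\Omega},\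 v\text{ is a pure Nash equilibrium}\},$$ where the entries of $u$ and $v$ are encoded in binary and $|N|$ and $|\Omega|$ in unary, is in $\mathrm{P}$: some Turing machine decides it in time polynomial in the length of the input. -/

import Mathlib

/-! ## No-budget multiple-issue quadratic voting

`N` is the finite society, `Ω` the finite set of outcomes, `α` the price constant,
`u i ω` the utility of outcome `ω` to agent `i`, and `v i ω` the integer number of votes that
agent `i` casts for `ω`.  The set of strategies of every agent is `Ω → ℤ`. -/

namespace QV

/-- Total number of votes for the outcome `ω`. -/
def totalVotes {N Ω : Type} [Fintype N] (v : N → Ω → ℤ) (ω : Ω) : ℤ :=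
  ∑ i, v i ω

/-- The set of possible winners: the outcomes with the highest total number of votes. -/
def winners {N Ω : Type} [Fintype N] [Fintype Ω] (v : N → Ω → ℤ) : Finset Ω :=
  Finset.univ.filter fun ω => ∀ φ, totalVotes v φ ≤ totalVotes v ω

/-- The probability that `ω` is elected, the winner being uniform on the possible winners. -/
noncomputable def winProb {N Ω : Type} [Fintype N] [Fintype Ω] [DecidableEq Ω]
    (v : N → Ω → ℤ) (ω : Ω) : ℝ :=
  if ω ∈ winners v then 1 / ((winners v).card : ℝ) else 0

/-- Total utility of agent `i`: expected outcome, minus payment, plus refund.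
(With a single agent the refund is `0`, being an empty sum.) -/
noncomputable def totalUtility {N Ω : Type} [Fintype N] [DecidableEq N] [Fintype Ω]
    [DecidableEq Ω] (α : ℝ) (u : N → Ω → ℝ) (i : N) (v : N → Ω → ℤ) : ℝ :=
  ∑ ω, u i ω * winProb v ω
    - α * ∑ ω, (v i ω : ℝ) ^ 2
    + α / ((Fintype.card N : ℝ) - 1) * ∑ j ∈ Finset.univ.erase i, ∑ ω, (v j ω : ℝ) ^ 2

/-- `v` is a pure Nash equilibrium: no agent gains by a unilateral change of strategy. -/
def IsPureNash {N Ω : Type} [Fintype N] [DecidableEq N] [Fintype Ω]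
    [DecidableEq Ω] (α : ℝ) (u : N → Ω → ℝ) (v : N → Ω → ℤ) : Prop :=
  ∀ (i : N) (σ : Ω → ℤ),
    totalUtility α u i (Function.update v i σ) ≤ totalUtility α u i v

/-! ## Instances and their encoding -/

/-- An instance `⟨N, Ω, u, v⟩`: `n` agents, `m` outcomes, an integer utility matrix and a
strategy profile. -/
structure Instance where
  n : ℕ
  m : ℕ
  u : Fin n → Fin m → ℤ
  v : Fin n → Fin m → ℤ

open Computability in
/-- An integer in binary: a sign bit (`true` for negative numbers), the binary digits of the
absolute value (least significant first, no superfluous zeros), and a terminating comma. -/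
def encodeInt (z : ℤ) : List Γ' :=
  Γ'.bit (decide (z < 0)) :: ((encodeNat z.natAbs).map Γ'.bit ++ [Γ'.comma])

/-- The entries of a matrix, row by row. -/
def encodeMatrix {n m : ℕ} (a : Fin n → Fin m → ℤ) : List Computability.Γ' :=
  (List.finRange n).flatMap fun i => (List.finRange m).flatMap fun j => encodeInt (a i j)

open Computability in
/-- The string that encodes an instance: one mark per agent, a comma, one mark per outcome, a
comma, and then the entries of `u` and of `v` in binary. -/
def Instance.encode (I : Instance) : List Γ' :=
  List.replicate I.n Γ'.bra ++ Γ'.comma :: (List.replicate I.m Γ'.bra ++ Γ'.comma ::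
    (encodeMatrix I.u ++ encodeMatrix I.v))

/-! ### The encoding is injective -/

theorem encodeInt_append_inj {y z : ℤ} {s t : List Computability.Γ'}
    (h : encodeInt y ++ s = encodeInt z ++ t) : y = z ∧ s = t := by
  have key : ∀ (a b : List Bool) (s t : List Computability.Γ'),
      a.map Computability.Γ'.bit ++ Computability.Γ'.comma :: s
        = b.map Computability.Γ'.bit ++ Computability.Γ'.comma :: t → a = b ∧ s = t := by
    intro a
    induction a with
    | nil => intro b s t h; cases b <;> simp_all
    | cons x a ih =>
      intro b s t h
      cases b with
      | nil => simp at h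
      | cons y b =>
        simp only [List.map_cons, List.cons_append, List.cons.injEq,
          Computability.Γ'.bit.injEq] at h
        obtain ⟨h1, h2⟩ := ih b s t h.2
        exact ⟨by rw [h.1, h1], h2⟩
  simp only [encodeInt, List.cons_append, List.append_assoc, List.nil_append, List.cons.injEq,
    Computability.Γ'.bit.injEq, decide_eq_decide] at h
  obtain ⟨h1, h2⟩ := key _ _ _ _ h.2
  have h3 : y.natAbs = z.natAbs := by
    rw [← Computability.decode_encodeNat y.natAbs, h1, Computability.decode_encodeNat]
  exact ⟨by omega, h2⟩

theorem flatMap_append_inj {ι β : Type} (f : β → List Computability.Γ')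
    (hf : ∀ (y z : β) (s t : List Computability.Γ'), f y ++ s = f z ++ t → y = z ∧ s = t)
    (a b : ι → β) (l : List ι) : ∀ s t : List Computability.Γ',
    (l.flatMap fun i => f (a i)) ++ s = (l.flatMap fun i => f (b i)) ++ t →
      (∀ i ∈ l, a i = b i) ∧ s = t := by
  induction l with
  | nil => intro s t h; simpa using h
  | cons x l ih =>
    intro s t h
    simp only [List.flatMap_cons, List.append_assoc] at h
    obtain ⟨h1, h2⟩ := hf _ _ _ _ h
    obtain ⟨h3, h4⟩ := ih _ _ h2
    exact ⟨by simpa [h1] using h3, h4⟩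

theorem encodeMatrix_append_inj {n m : ℕ} {a b : Fin n → Fin m → ℤ}
    {s t : List Computability.Γ'} (h : encodeMatrix a ++ s = encodeMatrix b ++ t) :
    a = b ∧ s = t := by
  obtain ⟨h1, h2⟩ := flatMap_append_inj
    (fun r : Fin m → ℤ => (List.finRange m).flatMap fun j => encodeInt (r j))
    (fun y z s t h => by
      obtain ⟨h1, h2⟩ := flatMap_append_inj encodeInt (fun _ _ _ _ => encodeInt_append_inj)
        y z (List.finRange m) s t h
      exact ⟨funext fun j => h1 j (List.mem_finRange j), h2⟩)
    a b (List.finRange n) s t h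
  exact ⟨funext fun i => h1 i (List.mem_finRange i), h2⟩

theorem Instance.encode_injective : Function.Injective Instance.encode := by
  have key : ∀ (a b : ℕ) (s t : List Computability.Γ'),
      List.replicate a Computability.Γ'.bra ++ Computability.Γ'.comma :: s
        = List.replicate b Computability.Γ'.bra ++ Computability.Γ'.comma :: t →
        a = b ∧ s = t := by
    intro a
    induction a with
    | zero => intro b s t h; cases b <;> simp_all [List.replicate_succ]
    | succ a ih =>
      intro b s t h
      cases b with
      | zero => simp [List.replicate_succ] at h
      | succ b =>
        simp only [List.replicate_succ, List.cons_append, List.cons.injEq, true_and] at h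
        obtain ⟨h1, h2⟩ := ih b s t h
        exact ⟨by rw [h1], h2⟩
  rintro ⟨n, m, u, v⟩ ⟨n', m', u', v'⟩ h
  obtain ⟨h1, h⟩ := key _ _ _ _ h
  obtain ⟨h2, h⟩ := key _ _ _ _ h
  dsimp only at h1 h2 h
  subst h1 h2
  obtain ⟨h3, h⟩ := encodeMatrix_append_inj h
  obtain ⟨h4, -⟩ := encodeMatrix_append_inj (s := []) (t := []) (by simpa using h)
  subst h3 h4
  rfl

/-- The language of the encodings of all instances `⟨N, Ω, u, v⟩` such that `v` is a pure Nash
equilibrium of the election with price constant `α`. -/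
def QVNE (α : ℝ) : Language Computability.Γ' :=
  {w | ∃ I : Instance, I.encode = w ∧ IsPureNash α (fun i ω => (I.u i ω : ℝ)) I.v}

end QV

open scoped Classical in
/-- The class P: some Turing machine decides membership in `L`, for all strings over the
alphabet, in a number of steps bounded by a polynomial in the length of the string. -/
def InP {Γ : Type} (L : Language Γ) : Prop :=
  Nonempty (Turing.TM2ComputableInPolyTime (id : List Γ → List Γ) Computability.encodeBool
    (fun w => decide (w ∈ L)))

/-! ## Structured programs over stacks, and their translation to Turing machines -/

namespace StackProg

open Computability Turing Function

/-! Game theory. The refund of an agent does not depend on its own votes, so `v` is an equilibrium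
exactly if each `v i` is a best response to the total votes `S` of the others (`isPureNash_iff`). A
deviation matters only through its set `W` of winners, their common total `t` and its cost. For
given `W` and `t` the cheapest votes are explicit (`dev`). For fixed `t` and `k = |W|` the payoff
is, up to a positive factor and a constant, a sum over `W` of individual values, so that some best
`W` consists of the `k` outcomes of highest value. It thus suffices to test few sets for each `t`
(`isBest_iff`).

The obstacle is `t`: votes are written in binary, so a priori there are exponentially many
thresholds. But optimal agents waste no votes: losers get no positive votes, they get negative ones
only if they trail by exactly one, tied winners get at most two votes per agent, and so on. Hence in
an equilibrium all totals of all but one agents are at most `2 * n + 1` in absolute value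
(`abs_others_le`). A profile that violates this is rejected; otherwise thresholds can be clamped to
a range of `4 * n + 4` numbers (`exists_cost_dev_le`).

Complexity. The resulting test is written as a fixed arithmetical expression about the input word,
built from sums over positions, products and comparisons. Each construct increases time and digit
lengths only polynomially (`Expr.exists_good`). Expressions are compiled to structured stack
programs, and these to Turing machines (`Runs.steps`, `inP_of_prog`), so whatever an expression
defines is in P (`inP_of_expr`). It remains to express that a word is an encoding (`valid_iff`,
`holds_validE`) and that the encoded profile is an equilibrium (`holds_nashE`). -/

/-- Structured programs that manipulate stacks `0, 1, 2, …` of symbols and a variable in `V`. -/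
inductive Prog (V : Type)
  | skip : Prog V
  | push (k : ℕ) (f : V → Γ') : Prog V
  | pop (k : ℕ) (f : V → Option Γ' → V) : Prog V
  | load (f : V → V) : Prog V
  | seq (p q : Prog V) : Prog V
  | ite (c : V → Bool) (p q : Prog V) : Prog V
  | loop (c : V → Bool) (p : Prog V) : Prog V

variable {V : Type}

/-- All stacks used by the program have an index less than `p.width`. -/
def Prog.width : Prog V → ℕ
  | skip => 0
  | push k _ => k + 1
  | pop k _ => k + 1
  | load _ => 0
  | seq p q => max p.width q.width
  | ite _ p q => max p.width q.width
  | loop _ p => p.width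

/-- `Runs p v S v' S' t`: the program `p`, started with variable `v` and stacks `S`, terminates
after `t` steps with variable `v'` and stacks `S'`. -/
inductive Runs : Prog V → V → (ℕ → List Γ') → V → (ℕ → List Γ') → ℕ → Prop
  | skip (v S) : Runs .skip v S v S 1
  | push (k f v S) : Runs (.push k f) v S v (update S k (f v :: S k)) 1
  | pop (k f v S) : Runs (.pop k f) v S (f v (S k).head?) (update S k (S k).tail) 1
  | load (f v S) : Runs (.load f) v S (f v) S 1
  | seq {p q v S v' S' v'' S'' t t'} : Runs p v S v' S' t → Runs q v' S' v'' S'' t' →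
      Runs (.seq p q) v S v'' S'' (t + t')
  | ite_true {c p q v S v' S' t} : c v = true → Runs p v S v' S' t →
      Runs (.ite c p q) v S v' S' (1 + t)
  | ite_false {c p q v S v' S' t} : c v = false → Runs q v S v' S' t →
      Runs (.ite c p q) v S v' S' (1 + t)
  | loop_true {c p v S v' S' v'' S'' t t'} : c v = true → Runs p v S v' S' t →
      Runs (.loop c p) v' S' v'' S'' t' → Runs (.loop c p) v S v'' S'' (1 + t + t')
  | loop_false {c p v S} : c v = false → Runs (.loop c p) v S v S 1

/-! ### Compilation of structured programs to `TM2` machines -/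

/-- The control points of a program. -/
def Lab : Prog V → Type
  | .seq p q => Lab p ⊕ Lab q
  | .ite _ p q => Option (Lab p ⊕ Lab q)
  | .loop _ p => Option (Lab p)
  | _ => Unit

/-- A program has finitely many control points. -/
@[reducible] noncomputable def Lab.fintype : (p : Prog V) → Fintype (Lab p)
  | .skip => inferInstanceAs (Fintype Unit)
  | .push _ _ => inferInstanceAs (Fintype Unit)
  | .pop _ _ => inferInstanceAs (Fintype Unit)
  | .load _ => inferInstanceAs (Fintype Unit)
  | .seq p q =>
    haveI := Lab.fintype p
    haveI := Lab.fintype q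
    inferInstanceAs (Fintype (Lab p ⊕ Lab q))
  | .ite _ p q =>
    haveI := Lab.fintype p
    haveI := Lab.fintype q
    inferInstanceAs (Fintype (Option (Lab p ⊕ Lab q)))
  | .loop _ p =>
    haveI := Lab.fintype p
    inferInstanceAs (Fintype (Option (Lab p)))

/-- The control point at which a program starts. -/
def entry : (p : Prog V) → Lab p
  | .skip => ()
  | .push _ _ => ()
  | .pop _ _ => ()
  | .load _ => ()
  | .seq p _ => Sum.inl (entry p)
  | .ite _ _ _ => none
  | .loop _ _ => none

/-- The alphabets of the stacks of the machine: an output stack, and `R` stacks of symbols. -/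
abbrev Alph (R : ℕ) : Option (Fin R) → Type
  | none => Bool
  | some _ => Γ'

/-- The statements at the control points of a program that is embedded in a machine via `emb`,
and followed by the label `next`. -/
def code {Λ : Type} (R : ℕ) :
    (p : Prog V) → (emb : Lab p → Λ) → (next : Λ) → Lab p → TM2.Stmt (Alph R) Λ V
  | .skip, _, next => fun _ => .goto fun _ => next
  | .push k f, _, next => fun _ =>
    if h : k < R then .push (some ⟨k, h⟩) f (.goto fun _ => next) else .halt
  | .pop k f, _, next => fun _ =>
    if h : k < R then .pop (some ⟨k, h⟩) f (.goto fun _ => next) else .halt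
  | .load f, _, next => fun _ => .load f (.goto fun _ => next)
  | .seq p q, emb, next => fun
    | Sum.inl l => code R p (fun l => emb (Sum.inl l)) (emb (Sum.inr (entry q))) l
    | Sum.inr l => code R q (fun l => emb (Sum.inr l)) next l
  | .ite c p q, emb, next => fun
    | none => .branch c (.goto fun _ => emb (some (Sum.inl (entry p))))
        (.goto fun _ => emb (some (Sum.inr (entry q))))
    | some (Sum.inl l) => code R p (fun l => emb (some (Sum.inl l))) next l
    | some (Sum.inr l) => code R q (fun l => emb (some (Sum.inr l))) next l
  | .loop c p, emb, next => fun
    | none => .branch c (.goto fun _ => emb (some (entry p))) (.goto fun _ => next)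
    | some l => code R p (fun l => emb (some l)) (emb none) l

/-- The stacks of the machine, the output stack being empty. -/
def toStk (R : ℕ) (S : ℕ → List Γ') : ∀ k : Option (Fin R), List (Alph R k)
  | none => []
  | some i => S i

theorem toStk_update {R k : ℕ} (h : k < R) (S : ℕ → List Γ') (x : List Γ') :
    toStk R (update S k x) = update (toStk R S) (some ⟨k, h⟩) x := by
  funext j
  rcases j with _ | j
  · rw [update_of_ne (by simp)]; rfl
  · by_cases hj : j = ⟨k, h⟩
    · subst hj; simp [toStk]
    · rw [update_of_ne (by simpa using hj)]
      have : (j : ℕ) ≠ k := fun h' => hj (Fin.ext h')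
      simp [toStk, this]

/-- The machine `M` moves from `c` to `c'` in exactly `t` steps. -/
def Steps {R : ℕ} {Λ : Type} (M : Λ → TM2.Stmt (Alph R) Λ V) (t : ℕ)
    (c c' : TM2.Cfg (Alph R) Λ V) : Prop :=
  (flip bind (TM2.step M))^[t] (some c) = some c'

theorem Steps.trans {R : ℕ} {Λ : Type} {M : Λ → TM2.Stmt (Alph R) Λ V} {t t' : ℕ}
    {c c' c'' : TM2.Cfg (Alph R) Λ V} (h : Steps M t c c') (h' : Steps M t' c' c'') :
    Steps M (t + t') c c'' := by
  rw [Steps, add_comm, iterate_add_apply, h, h']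

theorem Steps.one {R : ℕ} {Λ : Type} {M : Λ → TM2.Stmt (Alph R) Λ V} {l : Λ} {v : V}
    {S : ∀ k, List (Alph R k)} {c : TM2.Cfg (Alph R) Λ V}
    (h : TM2.stepAux (M l) v S = c) : Steps M 1 ⟨some l, v, S⟩ c := by
  subst h; rfl

/-- Induction on the run. `emb` and `next` are arbitrary, since the code of a subprogram sits inside
a larger machine and exits to a label of the enclosing program. Each basic operation and each test
is one machine step, so the step counts agree exactly. -/
theorem Runs.steps {R : ℕ} {p : Prog V} {v v' : V} {S S' : ℕ → List Γ'} {t : ℕ}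
    (h : Runs p v S v' S' t) : ∀ {Λ : Type} (M : Λ → TM2.Stmt (Alph R) Λ V) (emb : Lab p → Λ)
      (next : Λ), (∀ l, M (emb l) = code R p emb next l) → p.width ≤ R →
      Steps M t ⟨some (emb (entry p)), v, toStk R S⟩ ⟨some next, v', toStk R S'⟩ := by
  induction h with
  | skip v S =>
    intro Λ M emb next hM hR
    exact Steps.one (by rw [hM]; rfl)
  | push k f v S =>
    intro Λ M emb next hM hR
    have hk : k < R := hR
    exact Steps.one (by rw [hM, toStk_update hk]; simp [code, hk, toStk])
  | pop k f v S =>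
    intro Λ M emb next hM hR
    have hk : k < R := hR
    exact Steps.one (by rw [hM, toStk_update hk]; simp [code, hk, toStk])
  | load f v S =>
    intro Λ M emb next hM hR
    exact Steps.one (by rw [hM]; rfl)
  | @seq p q v S v' S' v'' S'' t t' _ _ ih1 ih2 =>
    intro Λ M emb next hM hR
    rw [Prog.width, max_le_iff] at hR
    exact (ih1 M (fun l => emb (Sum.inl l)) (emb (Sum.inr (entry q)))
      (fun l => hM (Sum.inl l)) hR.1).trans
      (ih2 M (fun l => emb (Sum.inr l)) next (fun l => hM (Sum.inr l)) hR.2)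
  | @ite_true c p q v S v' S' t hc _ ih =>
    intro Λ M emb next hM hR
    rw [Prog.width, max_le_iff] at hR
    refine Steps.trans (Steps.one ?_) (ih M (fun l => emb (some (Sum.inl l))) next
      (fun l => hM (some (Sum.inl l))) hR.1)
    rw [hM]; simp [code, hc, entry]
  | @ite_false c p q v S v' S' t hc _ ih =>
    intro Λ M emb next hM hR
    rw [Prog.width, max_le_iff] at hR
    refine Steps.trans (Steps.one ?_) (ih M (fun l => emb (some (Sum.inr l))) next
      (fun l => hM (some (Sum.inr l))) hR.2)
    rw [hM]; simp [code, hc, entry]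
  | @loop_true c p v S v' S' v'' S'' t t' hc _ _ ih1 ih2 =>
    intro Λ M emb next hM hR
    refine (Steps.trans (Steps.one ?_) (ih1 M (fun l => emb (some l)) (emb none)
      (fun l => hM (some l)) hR)).trans (ih2 M emb next hM hR)
    rw [hM]; simp [code, hc, entry]
  | @loop_false c p v S hc =>
    intro Λ M emb next hM hR
    refine Steps.one ?_
    rw [hM]; simp [code, hc, entry]

/-- The statements of the machine that runs `p`, writes the answer `out` that is read off the
variable, and halts. -/
def machineCode (p : Prog V) (v₀ : V) (out : V → Bool) :
    Option (Lab p) → TM2.Stmt (Alph (p.width + 1)) (Option (Lab p)) V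
  | some l => code _ p some none l
  | none => .push none out (.load (fun _ => v₀) .halt)

/-- The machine that runs `p` with input and output. -/
noncomputable def machine [Fintype V] (p : Prog V) (v₀ : V) (out : V → Bool) : FinTM2 where
  K := Option (Fin (p.width + 1))
  k₀ := some 0
  k₁ := none
  Γ := Alph (p.width + 1)
  Λ := Option (Lab p)
  main := some (entry p)
  ΛFin := haveI := Lab.fintype p; inferInstance
  σ := V
  initialState := v₀
  Γk₀Fin := inferInstanceAs (Fintype Γ')
  m := machineCode p v₀ out

/-- Halting with an output prescribes the whole final configuration: the initial variable, and empty
stacks apart from the output. Hence the program has to empty all its stacks; the closing statement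
of `machineCode` resets the variable, and costs the one step added to `P`. -/
theorem inP_of_prog [Fintype V] {L : Language Γ'} (p : Prog V) (v₀ : V) (out : V → Bool)
    (P : Polynomial ℕ)
    (h : ∀ w : List Γ', ∃ v', ∃ t ≤ P.eval w.length,
      Runs p v₀ (update (fun _ => []) 0 w) v' (fun _ => []) t ∧ (out v' = true ↔ w ∈ L)) :
    InP L := by
  classical
  choose v' t ht hr hL using h
  refine ⟨⟨⟨machine p v₀ out, Equiv.refl _, Equiv.refl _⟩, P + 1, fun w => ?_⟩⟩
  refine ⟨⟨t w + 1, ?_⟩, ?_⟩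
  · have h1 := (hr w).steps (R := p.width + 1) (machineCode p v₀ out) some none
      (fun _ => rfl) (Nat.le_succ _)
    have h2 : Steps (machineCode p v₀ out) 1 ⟨some none, v' w, toStk _ (fun _ => [])⟩
        ⟨none, v₀, update (toStk _ (fun _ => [])) none [out (v' w)]⟩ := by
      refine Steps.one ?_
      simp [machineCode, toStk]
    have h3 := h1.trans h2
    have e1 : initList (machine p v₀ out) w
        = ⟨some (some (entry p)), v₀, toStk _ (update (fun _ => []) 0 w)⟩ := by
      refine congrArg (TM2.Cfg.mk _ _) ?_
      funext k
      rcases k with _ | k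
      · exact dif_neg (by simp [machine])
      · by_cases hk : k = 0
        · subst hk
          exact dif_pos rfl
        · have : (k : ℕ) ≠ 0 := fun h => hk (Fin.ext h)
          refine (dif_neg (by simpa [machine] using hk)).trans ?_
          exact (update_of_ne this w (fun _ => [])).symm
    have e2 : haltList (machine p v₀ out) [out (v' w)]
        = ⟨none, v₀, update (toStk _ (fun _ => [])) none [out (v' w)]⟩ := by
      refine congrArg (TM2.Cfg.mk _ _) ?_
      funext k
      rcases k with _ | k
      · exact dif_pos rfl
      · exact dif_neg (by simp [machine])
    have e3 : decide (w ∈ L) = out (v' w) := by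
      rw [Bool.eq_iff_iff, hL]; simp
    refine Eq.trans (congrArg (flip bind (TM2.step (machineCode p v₀ out)))^[t w + 1]
      (congrArg some ?_)) (Eq.trans h3 (congrArg some ?_))
    · exact Eq.trans (congrArg _ (List.map_id w)) e1
    · exact Eq.trans e2.symm (by rw [e3]; rfl)
  · simpa using ht w

end StackProg

/-! ## Binary arithmetic on stacks -/

namespace StackProg

open Computability Turing Function

/-- The variable of our programs: a flag, and two registers for symbols. -/
abbrev Var : Type := Bool × Option Γ' × Option Γ'

/-- The digit that a symbol stands for. -/
def digit : Γ' → ℕ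
  | .bit true => 1
  | _ => 0

/-- The number that a list of symbols stands for, the least significant digit being the first. -/
def val : List Γ' → ℕ
  | [] => 0
  | a :: l => digit a + 2 * val l

/-- The digit of the symbol in a register, if any. -/
def isOne : Option Γ' → Bool
  | some (.bit true) => true
  | _ => false

theorem digit_bit (b : Bool) : digit (.bit b) = b.toNat := by cases b <;> rfl

theorem digit_eq (a : Γ') : digit a = (isOne (some a)).toNat := by
  rcases a with _ | (_ | _) | _ | _ | _ <;> rfl

theorem val_eq (l : List Γ') : val l = (isOne l.head?).toNat + 2 * val l.tail := by
  cases l with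
  | nil => rfl
  | cons a l => simp [val, digit_eq]

theorem val_append (l l' : List Γ') : val (l ++ l') = val l + 2 ^ l.length * val l' := by
  induction l with
  | nil => simp [val]
  | cons a l ih => simp [val, ih, pow_succ]; ring

theorem val_singleton (a : Γ') : val [a] = digit a := by simp [val]

/-! ### Specifications with time bounds, and loops over stacks -/

/-- Started with flag `f` and stacks `S`, the program ends with flag `f'` and stacks `S'`, after at
most `t` steps. -/
def Does (p : Prog Var) (f : Bool) (S : ℕ → List Γ') (f' : Bool) (S' : ℕ → List Γ') (t : ℕ) :
    Prop :=
  ∀ r, ∃ r' t', t' ≤ t ∧ Runs p (f, r) S (f', r') S' t'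

theorem Does.mono {p : Prog Var} {f f' S S' t t'} (h : Does p f S f' S' t) (ht : t ≤ t') :
    Does p f S f' S' t' := fun r =>
  let ⟨r', s, hs, h'⟩ := h r
  ⟨r', s, hs.trans ht, h'⟩

theorem Does.seq {p q : Prog Var} {f f' f'' S S' S'' t t'} (h : Does p f S f' S' t)
    (h' : Does q f' S' f'' S'' t') : Does (.seq p q) f S f'' S'' (t + t') := fun r =>
  let ⟨r₁, s₁, hs₁, h₁⟩ := h r
  let ⟨r₂, s₂, hs₂, h₂⟩ := h' r₁
  ⟨r₂, s₁ + s₂, add_le_add hs₁ hs₂, .seq h₁ h₂⟩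

theorem Does.congr {p : Prog Var} {f f' S S' S'' t} (h : Does p f S f' S' t) (hS : S' = S'') :
    Does p f S f' S'' t := hS ▸ h

theorem does_skip (f S) : Does .skip f S f S 1 := fun r => ⟨r, 1, le_rfl, .skip _ _⟩

/-- Push a symbol. -/
def put (k : ℕ) (a : Γ') : Prog Var := .push k fun _ => a

theorem does_put (k a f S) : Does (put k a) f S f (update S k (a :: S k)) 1 := fun r =>
  ⟨r, 1, le_rfl, .push _ _ _ _⟩

/-- Set the flag. -/
def setFlag (f : Bool) : Prog Var := .load fun v => (f, v.2)

theorem does_setFlag (f f' S) : Does (setFlag f') f S f' S 1 := fun r =>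
  ⟨r, 1, le_rfl, .load _ _ _⟩

/-- Push the flag. -/
def putFlag (k : ℕ) : Prog Var := .push k fun v => .bit v.1

theorem does_putFlag (k f S) : Does (putFlag k) f S f (update S k (.bit f :: S k)) 1 := fun r =>
  ⟨r, 1, le_rfl, .push _ _ _ _⟩

/-- Pop a symbol into the first register. -/
def popX (k : ℕ) : Prog Var := .pop k fun v x => (v.1, x, v.2.2)

/-- Pop a symbol into the second register. -/
def popY (k : ℕ) : Prog Var := .pop k fun v y => (v.1, v.2.1, y)

/-- Pop all symbols from a stack, and execute `p` for each of them, the symbol being in the first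
register. -/
def forEach (k : ℕ) (p : Prog Var) : Prog Var :=
  .seq (popX k) (.loop (fun v => v.2.1.isSome) (.seq p (popX k)))

/-- `Does`, for a program that is started with `a` in the first register. -/
def DoesOn (a : Γ') (p : Prog Var) (f : Bool) (S : ℕ → List Γ') (f' : Bool) (S' : ℕ → List Γ')
    (t : ℕ) : Prop :=
  ∀ y, ∃ r' t', t' ≤ t ∧ Runs p (f, some a, y) S (f', r') S' t'

theorem Does.on {p : Prog Var} {f f' S S' t} (h : Does p f S f' S' t) (a : Γ') :
    DoesOn a p f S f' S' t := fun _ => h _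

theorem DoesOn.congr {a : Γ'} {p : Prog Var} {f f' S S' S'' t} (h : DoesOn a p f S f' S' t)
    (hS : S' = S'') : DoesOn a p f S f' S'' t := hS ▸ h

theorem DoesOn.mono {a : Γ'} {p : Prog Var} {f f' S S' t t'} (h : DoesOn a p f S f' S' t)
    (ht : t ≤ t') : DoesOn a p f S f' S' t' := fun r =>
  let ⟨r', s, hs, h'⟩ := h r
  ⟨r', s, hs.trans ht, h'⟩

theorem DoesOn.seq {a : Γ'} {p q : Prog Var} {f f' f'' S S' S'' t t'}
    (h : DoesOn a p f S f' S' t) (h' : Does q f' S' f'' S'' t') :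
    DoesOn a (.seq p q) f S f'' S'' (t + t') := fun r =>
  let ⟨r₁, s₁, hs₁, h₁⟩ := h r
  let ⟨r₂, s₂, hs₂, h₂⟩ := h' r₁
  ⟨r₂, s₁ + s₂, add_le_add hs₁ hs₂, .seq h₁ h₂⟩

/-- `I l f S` is the loop invariant, `l` being what is still on stack `k`. An iteration costs `T`, a
test and a pop; the summand `2` accounts for the first pop and the last test. The body may spoil the
registers, since the next pop refills the first one. -/
theorem does_forEach {k : ℕ} {p : Prog Var} {T : ℕ} (I : List Γ' → Bool → (ℕ → List Γ') → Prop)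
    (hk : ∀ l f S, I l f S → S k = l)
    (hp : ∀ a l f S, I (a :: l) f S → ∃ f' S', I l f' S' ∧ DoesOn a p f (update S k l) f' S' T)
    {l : List Γ'} {f : Bool} {S : ℕ → List Γ'} (h : I l f S) :
    ∃ f' S', I [] f' S' ∧ Does (forEach k p) f S f' S' (2 + l.length * (T + 2)) := by
  have key : ∀ (l : List Γ') (f : Bool) (S : ℕ → List Γ'), I l f S → ∃ f' S', I [] f' S' ∧
      ∀ y, ∃ r' t', t' ≤ 1 + l.length * (T + 2) ∧
        Runs (.loop (fun v => v.2.1.isSome) (.seq p (popX k))) (f, l.head?, y)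
          (update S k l.tail) (f', r') S' t' := by
    intro l
    induction l with
    | nil =>
      intro f S h
      refine ⟨f, S, h, fun y => ⟨(none, y), 1, by simp, ?_⟩⟩
      have := hk _ _ _ h
      rw [show update S k ([] : List Γ').tail = S by rw [List.tail_nil, ← this, update_eq_self]]
      exact .loop_false rfl
    | cons a l ih =>
      intro f S h
      obtain ⟨f₁, S₁, h₁, hd⟩ := hp a l f S h
      obtain ⟨f₂, S₂, h₂, hr⟩ := ih f₁ S₁ h₁
      refine ⟨f₂, S₂, h₂, fun y => ?_⟩
      obtain ⟨⟨x', y'⟩, t', ht', hd⟩ := hd y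
      obtain ⟨r'', t'', ht'', hr⟩ := hr y'
      refine ⟨r'', 1 + (t' + 1) + t'', ?_, .loop_true rfl (.seq hd (.pop _ _ _ _)) ?_⟩
      · rw [List.length_cons, add_mul]; omega
      · rw [hk _ _ _ h₁]; exact hr
  obtain ⟨f', S', h', hr⟩ := key l f S h
  refine ⟨f', S', h', fun r => ?_⟩
  obtain ⟨r', t', ht', hr⟩ := hr r.2
  refine ⟨r', 1 + t', by omega, .seq (.pop _ _ _ _) ?_⟩
  rw [hk _ _ _ h]; exact hr

/-- Move the symbols of one stack to another one, reversing the order. -/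
def move (a b : ℕ) : Prog Var := forEach a (.push b fun v => v.2.1.getD default)

theorem does_move {a b : ℕ} (hab : a ≠ b) (f S) :
    Does (move a b) f S f (update (update S a []) b ((S a).reverse ++ S b))
      (2 + (S a).length * 3) := by
  obtain ⟨f', S', ⟨rfl, l', h1, rfl⟩, h⟩ := does_forEach (k := a)
    (p := .push b fun v => v.2.1.getD default) (T := 1) (f := f) (S := S) (l := S a)
    (fun l f' S' => f' = f ∧ ∃ l', l' ++ l = S a ∧
      S' = update (update S a l) b (l'.reverse ++ S b))
    (by rintro l f' S' ⟨-, l', -, rfl⟩; simp [hab])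
    (by
      rintro x l f' S' ⟨rfl, l', h, rfl⟩
      refine ⟨f', _, ⟨rfl, l' ++ [x], by simp [h], rfl⟩, fun y => ⟨(some x, y), 1, le_rfl, ?_⟩⟩
      convert Runs.push _ _ _ _ using 1
      grind [update_apply])
    ⟨rfl, [], rfl, by simp⟩
  simp only [List.append_nil] at h1
  subst h1
  exact h

/-- Move the symbols of one stack to two other ones, reversing the order. -/
def fork (c a b : ℕ) : Prog Var :=
  forEach c (.seq (.push a fun v => v.2.1.getD default) (.push b fun v => v.2.1.getD default))

theorem does_fork {a b c : ℕ} (hca : c ≠ a) (hcb : c ≠ b) (hab : a ≠ b) (f S) :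
    Does (fork c a b) f S f (update (update (update S c []) a ((S c).reverse ++ S a)) b
      ((S c).reverse ++ S b)) (2 + (S c).length * 4) := by
  obtain ⟨f', S', ⟨rfl, l', h1, rfl⟩, h⟩ := does_forEach (k := c)
    (p := .seq (.push a fun v => v.2.1.getD default) (.push b fun v => v.2.1.getD default))
    (T := 2) (f := f) (S := S) (l := S c)
    (fun l f' S' => f' = f ∧ ∃ l', l' ++ l = S c ∧
      S' = update (update (update S c l) a (l'.reverse ++ S a)) b (l'.reverse ++ S b))
    (by rintro l f' S' ⟨-, l', -, rfl⟩; simp [hca, hcb])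
    (by
      rintro x l f' S' ⟨rfl, l', h, rfl⟩
      refine ⟨f', _, ⟨rfl, l' ++ [x], by simp [h], rfl⟩, fun y => ⟨(some x, y), 2, le_rfl, ?_⟩⟩
      convert Runs.seq (Runs.push _ _ _ _) (Runs.push _ _ _ _) using 1
      grind [update_apply])
    ⟨rfl, [], rfl, by simp⟩
  simp only [List.append_nil] at h1
  subst h1
  exact h

/-- Copy a number from `a` to the empty stack `b`, via the empty stack `c`. -/
def copy (a b c : ℕ) : Prog Var := .seq (move a c) (fork c a b)

theorem does_copy {a b c : ℕ} (hca : c ≠ a) (hcb : c ≠ b) (hab : a ≠ b) (f : Bool)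
    {S : ℕ → List Γ'} (hb : S b = []) (hc : S c = []) :
    Does (copy a b c) f S f (update S b (S a)) (4 + (S a).length * 7) := by
  refine (((does_move hca.symm f S).seq (does_fork hca hcb hab f _)).congr ?_).mono ?_
  · grind [update_apply]
  · simp [hc]; omega

/-- Remove all symbols from a stack. -/
def clear (a : ℕ) : Prog Var := forEach a .skip

theorem does_clear (a : ℕ) (f S) : Does (clear a) f S f (update S a []) (2 + (S a).length * 3) := by
  obtain ⟨f', S', ⟨rfl, rfl⟩, h⟩ := does_forEach (k := a) (p := .skip) (T := 1) (f := f) (S := S)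
    (l := S a) (fun l f' S' => f' = f ∧ S' = update S a l)
    (by rintro l f' S' ⟨-, rfl⟩; simp)
    (by
      rintro x l f' S' ⟨rfl, rfl⟩
      exact ⟨f', _, ⟨rfl, rfl⟩, ((does_skip _ _).on x).congr (by simp)⟩)
    ⟨rfl, by simp⟩
  exact h

/-- Remove a number, and set the flag if it is not zero. -/
def test (a : ℕ) : Prog Var :=
  .seq (setFlag false) (forEach a (.load fun v => (v.1 || isOne v.2.1, v.2)))

theorem does_test (a : ℕ) (f S) :
    Does (test a) f S (decide (val (S a) ≠ 0)) (update S a []) (3 + (S a).length * 3) := by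
  obtain ⟨f', S', ⟨h1, rfl⟩, h⟩ := does_forEach (k := a)
    (p := .load fun v => (v.1 || isOne v.2.1, v.2)) (T := 1) (f := false) (S := S)
    (l := S a) (fun l f' S' => (decide (val (S a) ≠ 0) = (f' || decide (val l ≠ 0))) ∧
      S' = update S a l)
    (by rintro l f' S' ⟨-, rfl⟩; simp)
    (by
      rintro x l f' S' ⟨h, rfl⟩
      refine ⟨f' || isOne (some x), _, ⟨?_, rfl⟩, fun y => ⟨(some x, y), 1, le_rfl, ?_⟩⟩
      · rw [h, Bool.or_assoc]
        congr 1
        rw [val, digit_eq]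
        cases isOne (some x) <;> simp
      · rw [update_idem]
        exact Runs.load _ _ _)
    ⟨by simp, by simp⟩
  have h2 : f' = decide (val (S a) ≠ 0) := by rw [h1]; simp [val]
  subst h2
  exact ((does_setFlag f false S).seq h).mono (by omega)

/-- Pop symbols from two stacks until both are empty, executing `p` with the symbols in the
registers. -/
def zipLoop (a b : ℕ) (p : Prog Var) : Prog Var :=
  .seq (.seq (popX a) (popY b))
    (.loop (fun v => v.2.1.isSome || v.2.2.isSome) (.seq p (.seq (popX a) (popY b))))

/-- The number of iterations is the larger of the two lengths: an exhausted stack yields `none`,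
which `isOne` reads as the digit zero, so the shorter number is padded in the applications. -/
theorem does_zipLoop {a b : ℕ} {p : Prog Var} {T : ℕ} (hab : a ≠ b)
    (I : List Γ' → List Γ' → Bool → (ℕ → List Γ') → Prop)
    (ha : ∀ l m f S, I l m f S → S a = l) (hb : ∀ l m f S, I l m f S → S b = m)
    (hp : ∀ l m f S, I l m f S → l ≠ [] ∨ m ≠ [] → ∃ f' S' t', t' ≤ T ∧ I l.tail m.tail f' S' ∧
      Runs p (f, l.head?, m.head?) (update (update S a l.tail) b m.tail)
        (f', l.head?, m.head?) S' t')
    {l m : List Γ'} {f : Bool} {S : ℕ → List Γ'} (h : I l m f S) :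
    ∃ f' S', I [] [] f' S' ∧
      Does (zipLoop a b p) f S f' S' (3 + max l.length m.length * (T + 3)) := by
  have key : ∀ (n : ℕ) (l m : List Γ') (f : Bool) (S : ℕ → List Γ'), max l.length m.length = n →
      I l m f S → ∃ f' S', I [] [] f' S' ∧ ∃ r' t', t' ≤ 1 + n * (T + 3) ∧
        Runs (.loop (fun v => v.2.1.isSome || v.2.2.isSome) (.seq p (.seq (popX a) (popY b))))
          (f, l.head?, m.head?) (update (update S a l.tail) b m.tail) (f', r') S' t' := by
    intro n
    induction n with
    | zero =>
      intro l m f S hn h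
      have hl : l = [] := List.eq_nil_of_length_eq_zero (by omega)
      have hm : m = [] := List.eq_nil_of_length_eq_zero (by omega)
      subst hl hm
      refine ⟨f, S, h, (none, none), 1, by simp, ?_⟩
      have h1 := ha _ _ _ _ h
      have h2 := hb _ _ _ _ h
      rw [show update (update S a ([] : List Γ').tail) b ([] : List Γ').tail = S by
        rw [List.tail_nil, ← h1, update_eq_self, h1, ← h2, update_eq_self]]
      exact .loop_false rfl
    | succ n ih =>
      intro l m f S hn h
      have hne : l ≠ [] ∨ m ≠ [] := by
        by_contra! h'
        simp [h'.1, h'.2] at hn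
      obtain ⟨f₁, S₁, t₁, ht₁, h₁, hd⟩ := hp l m f S h hne
      obtain ⟨f₂, S₂, h₂, r₂, t₂, ht₂, hr⟩ := ih l.tail m.tail f₁ S₁ (by simp; omega) h₁
      refine ⟨f₂, S₂, h₂, r₂, 1 + (t₁ + (1 + 1)) + t₂, ?_,
        .loop_true ?_ (.seq hd (.seq (.pop _ _ _ _) (.pop _ _ _ _))) ?_⟩
      · rw [add_mul]; omega
      · rcases hne with h' | h'
        · simp [List.isSome_head?, h']
        · simp [List.isSome_head?, h']
      · rw [update_of_ne hab.symm, hb _ _ _ _ h₁, ha _ _ _ _ h₁]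
        exact hr
  obtain ⟨f', S', h', r', t', ht', hr⟩ := key _ l m f S rfl h
  refine ⟨f', S', h', fun r => ⟨r', (1 + 1) + t', by omega,
    .seq (.seq (.pop _ _ _ _) (.pop _ _ _ _)) ?_⟩⟩
  rw [update_of_ne hab.symm, hb _ _ _ _ h, ha _ _ _ _ h]
  exact hr

/-! ### Comparison and addition -/

/-- One step of the comparison of two numbers. -/
def ltStep (f x y : Bool) : Bool := if x = y then f else y

/-- Replace the numbers in `a` and `b` by the truth value of their comparison, in `a`. -/
def less (a b : ℕ) : Prog Var :=
  .seq (setFlag false) (.seq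
    (zipLoop a b (.load fun v => (ltStep v.1 (isOne v.2.1) (isOne v.2.2), v.2))) (putFlag a))

/-- The digits arrive with the least significant first, so a later difference overrides earlier
ones: the flag compares the digits read so far, and it decides only if the remaining parts are
equal. -/
theorem does_less {a b : ℕ} (hab : a ≠ b) (f S) : ∃ f',
    Does (less a b) f S f' (update (update S a [.bit (decide (val (S a) < val (S b)))]) b [])
      (5 + max (S a).length (S b).length * 4) := by
  obtain ⟨f', S', ⟨h1, rfl⟩, h⟩ := does_zipLoop (a := a) (b := b)
    (p := .load fun v => (ltStep v.1 (isOne v.2.1) (isOne v.2.2), v.2))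
    (T := 1) (f := false) (S := S) (l := S a) (m := S b) hab
    (fun l m f' S' => ((val (S a) < val (S b)) ↔ (val l < val m ∨ val l = val m ∧ f' = true)) ∧
      S' = update (update S a l) b m)
    (by rintro l m f' S' ⟨-, rfl⟩; simp [hab])
    (by rintro l m f' S' ⟨-, rfl⟩; simp)
    (by
      rintro l m f' S' ⟨h, rfl⟩ -
      refine ⟨ltStep f' (isOne l.head?) (isOne m.head?), _, 1, le_rfl, ⟨?_, rfl⟩, ?_⟩
      · rw [h, val_eq l, val_eq m]
        cases isOne l.head? <;> cases isOne m.head? <;> cases f' <;> simp [ltStep] <;> omega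
      · rw [show update (update S a l.tail) b m.tail
          = update (update (update (update S a l) b m) a l.tail) b m.tail by
            grind [update_apply]]
        exact Runs.load _ _ _)
    ⟨by simp, by simp⟩
  refine ⟨f', (((does_setFlag f false S).seq (h.seq (does_putFlag a _ _))).congr ?_).mono
    (by omega)⟩
  have h2 : f' = decide (val (S a) < val (S b)) := by
    rw [Bool.eq_iff_iff, decide_eq_true_iff, h1]; simp [val]
  subst h2
  grind [update_apply]

/-- Add the number in `b` to the one in `a`, via the empty stack `c`. -/
def add (a b c : ℕ) : Prog Var :=
  .seq (setFlag false) (.seq (zipLoop a b (.seq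
    (.push c fun v => .bit (xor v.1 (xor (isOne v.2.1) (isOne v.2.2))))
    (.load fun v => (Bool.atLeastTwo v.1 (isOne v.2.1) (isOne v.2.2), v.2))))
    (.seq (putFlag c) (move c a)))

/-- The flag is the carry. The digits of the sum are collected on `c` in reverse order; the final
carry is always pushed, which makes the result one digit longer than the longer summand. -/
theorem does_add {a b c : ℕ} (hab : a ≠ b) (hca : c ≠ a) (hcb : c ≠ b) (f) {S : ℕ → List Γ'}
    (hc : S c = []) : ∃ f' L, val L = val (S a) + val (S b) ∧
      L.length = max (S a).length (S b).length + 1 ∧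
      Does (add a b c) f S f' (update (update S a L) b [])
        (10 + max (S a).length (S b).length * 8) := by
  obtain ⟨f', S', ⟨l', h0, h1, rfl⟩, h⟩ := does_zipLoop (a := a) (b := b)
    (p := .seq (.push c fun v => .bit (xor v.1 (xor (isOne v.2.1) (isOne v.2.2))))
      (.load fun v => (Bool.atLeastTwo v.1 (isOne v.2.1) (isOne v.2.2), v.2)))
    (T := 2) (f := false) (S := S) (l := S a) (m := S b) hab
    (fun l m f' S' => ∃ l', l'.length + max l.length m.length = max (S a).length (S b).length ∧
      val (S a) + val (S b) = val l'.reverse + 2 ^ l'.length * (val l + val m + f'.toNat) ∧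
      S' = update (update (update S a l) b m) c l')
    (by rintro l m f' S' ⟨l', -, -, rfl⟩; simp [hab, hca.symm])
    (by rintro l m f' S' ⟨l', -, -, rfl⟩; simp [hcb.symm])
    (by
      rintro l m f' S' ⟨l', h0, h, rfl⟩ hne
      refine ⟨Bool.atLeastTwo f' (isOne l.head?) (isOne m.head?), _, 2, le_rfl,
        ⟨.bit (xor f' (xor (isOne l.head?) (isOne m.head?))) :: l', ?_, ?_, rfl⟩, ?_⟩
      · rw [← h0]
        simp only [List.length_cons, List.length_tail]
        have : 0 < max l.length m.length := by
          rcases hne with h' | h'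
          · have := List.length_pos_iff.2 h'; omega
          · have := List.length_pos_iff.2 h'; omega
        omega
      · rw [h, val_eq l, val_eq m, List.reverse_cons, val_append, val_singleton, digit_bit,
          List.length_reverse, List.length_cons, pow_succ]
        cases isOne l.head? <;> cases isOne m.head? <;> cases f' <;>
          simp [Bool.atLeastTwo] <;> ring
      · convert Runs.seq (Runs.push _ _ _ _) (Runs.load _ _ _) using 1
        grind [update_apply])
    ⟨[], by simp, by simp [val], by grind [update_apply]⟩
  refine ⟨f', (Γ'.bit f' :: l').reverse, ?_, ?_, (((does_setFlag f false S).seq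
    (h.seq ((does_putFlag c _ _).seq (does_move hca _ _)))).congr ?_).mono ?_⟩
  · rw [h1, List.reverse_cons, val_append, val_singleton, digit_bit]
    simp [val]
  · rw [← h0]; simp
  · grind [update_apply]
  · simp at h0 ⊢; omega

end StackProg

/-! ### Multiplication -/

namespace StackProg

open Computability Turing Function

/-- Branch on the digit in the first register. -/
def ifX (s : Γ' → Bool) (p q : Prog Var) : Prog Var := .ite (fun v => s (v.2.1.getD default)) p q

theorem doesOn_ifX {s : Γ' → Bool} {a : Γ'} {p q : Prog Var} {f f' S S' t}
    (h : Does (if s a then p else q) f S f' S' t) : DoesOn a (ifX s p q) f S f' S' (1 + t) :=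
  fun y => by
  obtain ⟨r', t', ht', h⟩ := h (some a, y)
  refine ⟨r', 1 + t', by omega, ?_⟩
  cases hs : s a
  · exact .ite_false hs (by simpa [hs] using h)
  · exact .ite_true hs (by simpa [hs] using h)

/-- Multiply the number in `a` by the one in `b`, via three empty stacks. -/
def mul (a b c d e : ℕ) : Prog Var :=
  .seq (move a c) (.seq (forEach c (ifX (fun x => isOne (some x))
    (.seq (put a (.bit false)) (.seq (copy b d e) (add a d e)))
    (put a (.bit false)))) (clear b))

/-- Horner's scheme: after the move, the digits of the first factor come with the most significant
first. Each of them doubles the accumulator by pushing a zero and, if it is one, adds a copy of the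
second factor. A step adds at most two digits beyond the length of the second factor, whence the
length bound. -/
theorem does_mul {b : ℕ} (f) {S : ℕ → List Γ'} (hc : S (b + 2) = []) (hd : S (b + 3) = [])
    (he : S (b + 4) = []) : ∃ f' L, val L = val (S b) * val (S (b + 1)) ∧
      L.length ≤ 2 * (S b).length + (S (b + 1)).length ∧
      Does (mul b (b + 1) (b + 2) (b + 3) (b + 4)) f S f' (update (update S b L) (b + 1) [])
        (6 + 3 * (S b).length + 3 * (S (b + 1)).length +
          (S b).length * (40 + 16 * (S b).length + 15 * (S (b + 1)).length)) := by
  have hm := (does_move (show b ≠ b + 2 by omega) f S).congr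
    (show _ = update (update S b []) (b + 2) (S b).reverse by rw [hc, List.append_nil])
  obtain ⟨f', S', ⟨l', L, h0, h1, h2, rfl⟩, h⟩ := does_forEach (k := b + 2)
    (p := ifX (fun x => isOne (some x))
      (.seq (put b (.bit false)) (.seq (copy (b + 1) (b + 3) (b + 4)) (add b (b + 3) (b + 4))))
      (put b (.bit false)))
    (T := 34 + 16 * (S b).length + 15 * (S (b + 1)).length) (f := f)
    (S := update (update S b []) (b + 2) (S b).reverse) (l := (S b).reverse)
    (fun l f' S' => ∃ l' L, l' ++ l = (S b).reverse ∧
      val L = val l'.reverse * val (S (b + 1)) ∧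
      L.length ≤ 2 * l'.length + (S (b + 1)).length ∧
      S' = update (update S b L) (b + 2) l)
    (by rintro l f' S' ⟨l', L, -, -, -, rfl⟩; simp)
    (by
      rintro x l f' S' ⟨l', L, h0, h1, h2, rfl⟩
      have hlen : l'.length + (l.length + 1) = (S b).length := by
        have := congrArg List.length h0
        simpa using this
      have hp := does_put b (.bit false) f' (update (update (update S b L) (b + 2) (x :: l))
        (b + 2) l)
      cases hx : isOne (some x)
      · refine ⟨f', _, ⟨l' ++ [x], .bit false :: L, by simp [h0], ?_, ?_, rfl⟩,
          (doesOn_ifX (t := 1) ?_).mono (by omega)⟩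
        rotate_left 2
        · simp only [hx]; exact hp.congr (by grind [update_apply])
        · simp [val, digit_eq x, hx, show digit (.bit false) = 0 from rfl, h1]; ring
        · simp; omega
      · have hcp := does_copy (a := b + 1) (b := b + 3) (c := b + 4) (by simp) (by simp) (by simp)
          f' (S := update (update S b (.bit false :: L)) (b + 2) l) (by simpa using hd)
          (by simpa using he)
        obtain ⟨f₁, L', h3, h4, ha⟩ := does_add (a := b) (b := b + 3) (c := b + 4) (by simp)
          (by simp) (by simp) f' (S := update (update (update S b (.bit false :: L)) (b + 2) l)
            (b + 3) (S (b + 1))) (by simpa using he)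
        simp only [update_self, ne_eq, Nat.add_eq_left, OfNat.ofNat_ne_zero, not_false_eq_true,
          update_of_ne, Nat.add_left_cancel_iff, OfNat.one_ne_ofNat, Nat.left_eq_add,
          one_ne_zero] at hcp h3 h4 ha
        refine ⟨f₁, _, ⟨l' ++ [x], L', by simp [h0], ?_, ?_, rfl⟩,
          (doesOn_ifX (t := 1 + ((4 + (S (b + 1)).length * 7) +
            (10 + max (Γ'.bit false :: L).length (S (b + 1)).length * 8))) ?_).mono ?_⟩
        rotate_left 2
        · simp only [hx, if_true]
          exact ((hp.congr (by grind [update_apply])).seq (hcp.seq ha)).congr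
            (by grind [update_apply])
        · simp at h4 ⊢; omega
        · rw [h3]
          simp [val, digit_eq x, hx, show digit (.bit false) = 0 from rfl, h1]; ring
        · simp at h4 ⊢; omega)
    ⟨[], [], by simp, by simp [val], by simp, by simp⟩
  have hcl := does_clear (b + 1) f' (update (update S b L) (b + 2) [])
  rw [List.append_nil] at h0
  subst h0
  refine ⟨f', L, by simpa using h1, by simpa using h2, ((hm.seq (h.seq hcl)).congr ?_).mono ?_⟩
  · grind [update_apply]
  · simp; nlinarith

/-! ## Arithmetical expressions about a word -/

/-- Arithmetical expressions about a word, with variables that are named by numbers. -/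
inductive Expr
  | bit (b : Bool) : Expr
  | var (x : ℕ) : Expr
  | add (e₁ e₂ : Expr) : Expr
  | mul (e₁ e₂ : Expr) : Expr
  | lt (e₁ e₂ : Expr) : Expr
  | sub (x : ℕ) (e₁ e₂ : Expr) : Expr
  | sum (s : Γ' → Bool) (dbl : Bool) (x : ℕ) (e : Expr) : Expr

/-- One step of a summation: the symbol and the position `p`, the current sum `acc`. -/
def sumStep (s : Γ' → Bool) (dbl : Bool) (g : ℕ → ℕ) (acc : ℕ) (p : Γ' × ℕ) : ℕ :=
  if s p.1 then (if dbl then 2 * acc else acc) + g p.2 else acc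

/-- The value of an expression.  `sum s dbl x e` sums up `e` over all positions `x` of the word
that carry a symbol in `s`, doubling the sum in each step if `dbl` is set. -/
def Expr.eval (w : List Γ') : Expr → (ℕ → ℕ) → ℕ
  | bit b, _ => b.toNat
  | var x, ρ => ρ x
  | add e₁ e₂, ρ => e₁.eval w ρ + e₂.eval w ρ
  | mul e₁ e₂, ρ => e₁.eval w ρ * e₂.eval w ρ
  | lt e₁ e₂, ρ => (decide (e₁.eval w ρ < e₂.eval w ρ)).toNat
  | sub x e₁ e₂, ρ => e₂.eval w (update ρ x (e₁.eval w ρ))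
  | sum s dbl x e, ρ => w.zipIdx.foldl (sumStep s dbl fun j => e.eval w (update ρ x j)) 0

/-- The program that computes an expression.  The word is in stack `0`, the variable `x` in stack
`loc x`, the stacks from `b` on are empty, and the result goes to stack `b`. -/
def Expr.compile : Expr → (loc : ℕ → ℕ) → (b : ℕ) → Prog Var
  | bit c, _, b => put b (.bit c)
  | var x, loc, b => copy (loc x) b (b + 1)
  | add e₁ e₂, loc, b => .seq (e₁.compile loc b) (.seq (e₂.compile loc (b + 1))
      (StackProg.add b (b + 1) (b + 2)))
  | mul e₁ e₂, loc, b => .seq (e₁.compile loc b) (.seq (e₂.compile loc (b + 1))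
      (StackProg.mul b (b + 1) (b + 2) (b + 3) (b + 4)))
  | lt e₁ e₂, loc, b => .seq (e₁.compile loc b) (.seq (e₂.compile loc (b + 1)) (less b (b + 1)))
  | sub x e₁ e₂, loc, b => .seq (e₁.compile loc b) (.seq (e₂.compile (update loc x b) (b + 1))
      (.seq (clear b) (.seq (move (b + 1) (b + 2)) (move (b + 2) b))))
  | sum s dbl x e, loc, b => .seq (copy 0 (b + 2) (b + 3)) (.seq (forEach (b + 2)
      (.seq (ifX s (.seq (if dbl then put b (.bit false) else .skip)
        (.seq (e.compile (update loc x (b + 1)) (b + 3)) (StackProg.add b (b + 3) (b + 4)))) .skip)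
      (.seq (put (b + 3) (.bit true)) (StackProg.add (b + 1) (b + 3) (b + 4)))))
      (clear (b + 1)))

/-! ### Correctness and polynomial bounds for compiled expressions -/

/-- The stacks `S` represent the word `w` and the assignment `ρ` as expected by `Expr.compile`, the
numbers having at most `q` digits. -/
structure Represents (w : List Γ') (loc : ℕ → ℕ) (b : ℕ) (ρ : ℕ → ℕ) (q : ℕ)
    (S : ℕ → List Γ') : Prop where
  pos : 0 < b
  word : S 0 = w
  loc_lt : ∀ x, loc x < b
  val_eq : ∀ x, val (S (loc x)) = ρ x
  length_le : ∀ x, (S (loc x)).length ≤ q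
  empty : ∀ j, b ≤ j → S j = []

theorem Represents.push {w loc b ρ q S} (h : Represents w loc b ρ q S) (L : List Γ') :
    Represents w loc (b + 1) ρ q (update S b L) where
  pos := by omega
  word := by rw [update_of_ne h.pos.ne, h.word]
  loc_lt x := (h.loc_lt x).trans (by omega)
  val_eq x := by rw [update_of_ne (h.loc_lt x).ne, h.val_eq]
  length_le x := by rw [update_of_ne (h.loc_lt x).ne]; exact h.length_le x
  empty j hj := by rw [update_of_ne (by omega), h.empty j (by omega)]

/-- A variable is bound by redirecting its location to stack `k`; nothing is copied. -/
theorem Represents.assign {w loc b ρ q S} (h : Represents w loc b ρ q S) {k : ℕ} (hk : k < b)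
    (x : ℕ) {q' : ℕ} (hq : q ≤ q') (hL : (S k).length ≤ q') :
    Represents w (update loc x k) b (update ρ x (val (S k))) q' S where
  pos := h.pos
  word := h.word
  loc_lt y := by
    by_cases hy : y = x
    · subst hy; simpa
    · rw [update_of_ne hy]; exact h.loc_lt y
  val_eq y := by
    by_cases hy : y = x
    · subst hy; simp
    · rw [update_of_ne hy, update_of_ne hy]; exact h.val_eq y
  length_le y := by
    by_cases hy : y = x
    · subst hy; simpa
    · rw [update_of_ne hy]; exact (h.length_le y).trans hq
  empty := h.empty

/-- The program for `e` is correct, and needs polynomial time and space, if the numbers assigned to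
the variables have at most `Q.eval w.length` digits. -/
def Expr.Good (e : Expr) (Q P : Polynomial ℕ) : Prop :=
  ∀ w loc b ρ S f, Represents w loc b ρ (Q.eval w.length) S → ∃ f' L, val L = e.eval w ρ ∧
    L.length ≤ P.eval w.length ∧
    Does (e.compile loc b) f S f' (update S b L) (P.eval w.length)

theorem Expr.good_bit (c : Bool) (Q : Polynomial ℕ) : (Expr.bit c).Good Q 1 := by
  intro w loc b ρ S f h
  refine ⟨f, [.bit c], ?_, by simp, ((does_put b (.bit c) f S).congr ?_).mono (by simp)⟩
  · rw [val_singleton, digit_bit]; rfl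
  · rw [h.empty b le_rfl]

theorem Expr.good_var (x : ℕ) (Q : Polynomial ℕ) : (Expr.var x).Good Q (4 + 7 * Q) := by
  intro w loc b ρ S f h
  have h1 := h.length_le x
  have h2 := h.loc_lt x
  refine ⟨f, S (loc x), h.val_eq x, ?_, (does_copy (by omega) (by omega) (by omega) f
    (h.empty b le_rfl) (h.empty (b + 1) (by omega))).mono ?_⟩
  · simp; omega
  · simp; omega

theorem Expr.Good.add {e₁ e₂ : Expr} {Q P₁ P₂ : Polynomial ℕ} (h₁ : e₁.Good Q P₁)
    (h₂ : e₂.Good Q P₂) : (Expr.add e₁ e₂).Good Q (10 + 9 * P₁ + 9 * P₂) := by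
  intro w loc b ρ S f h
  obtain ⟨f₁, L₁, v₁, l₁, d₁⟩ := h₁ w loc b ρ S f h
  obtain ⟨f₂, L₂, v₂, l₂, d₂⟩ := h₂ w loc (b + 1) ρ _ f₁ (h.push L₁)
  obtain ⟨f₃, L, v, l, d⟩ := does_add (a := b) (b := b + 1) (c := b + 2) (by simp) (by simp)
    (by simp) f₂ (S := update (update S b L₁) (b + 1) L₂) (by simp [h.empty])
  simp only [ne_eq, one_ne_zero, not_false_eq_true, update_of_ne, update_self,
    Nat.left_eq_add] at v l d
  refine ⟨f₃, L, by rw [v, v₁, v₂]; rfl, ?_, ((d₁.seq (d₂.seq d)).congr ?_).mono ?_⟩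
  · simp; omega
  · grind [update_apply, h.empty (b + 1) (by omega)]
  · simp; omega

theorem Expr.Good.mul {e₁ e₂ : Expr} {Q P₁ P₂ : Polynomial ℕ} (h₁ : e₁.Good Q P₁)
    (h₂ : e₂.Good Q P₂) : (Expr.mul e₁ e₂).Good Q
      (6 + 4 * P₁ + 4 * P₂ + P₁ * (40 + 16 * P₁ + 15 * P₂)) := by
  intro w loc b ρ S f h
  obtain ⟨f₁, L₁, v₁, l₁, d₁⟩ := h₁ w loc b ρ S f h
  obtain ⟨f₂, L₂, v₂, l₂, d₂⟩ := h₂ w loc (b + 1) ρ _ f₁ (h.push L₁)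
  obtain ⟨f₃, L, v, l, d⟩ := does_mul (b := b) f₂ (S := update (update S b L₁) (b + 1) L₂)
    (by simp [h.empty]) (by simp [h.empty]) (by simp [h.empty])
  simp only [ne_eq, one_ne_zero, not_false_eq_true, update_of_ne, update_self,
    Nat.left_eq_add] at v l d
  refine ⟨f₃, L, by rw [v, v₁, v₂]; rfl, ?_, ((d₁.seq (d₂.seq d)).congr ?_).mono ?_⟩
  · simp; omega
  · grind [update_apply, h.empty (b + 1) (by omega)]
  · simp only [Polynomial.eval_add, Polynomial.eval_mul, Polynomial.eval_ofNat]
    have : L₁.length * (40 + 16 * L₁.length + 15 * L₂.length) ≤ Polynomial.eval w.length P₁ *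
      (40 + 16 * Polynomial.eval w.length P₁ + 15 * Polynomial.eval w.length P₂) := by gcongr
    omega

theorem Expr.Good.lt {e₁ e₂ : Expr} {Q P₁ P₂ : Polynomial ℕ} (h₁ : e₁.Good Q P₁)
    (h₂ : e₂.Good Q P₂) : (Expr.lt e₁ e₂).Good Q (5 + 5 * P₁ + 5 * P₂) := by
  intro w loc b ρ S f h
  obtain ⟨f₁, L₁, v₁, l₁, d₁⟩ := h₁ w loc b ρ S f h
  obtain ⟨f₂, L₂, v₂, l₂, d₂⟩ := h₂ w loc (b + 1) ρ _ f₁ (h.push L₁)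
  obtain ⟨f₃, d⟩ := does_less (a := b) (b := b + 1) (by simp) f₂
    (update (update S b L₁) (b + 1) L₂)
  simp only [ne_eq, one_ne_zero, not_false_eq_true, update_of_ne, update_self,
    Nat.left_eq_add] at d
  refine ⟨f₃, [.bit (decide (val L₁ < val L₂))], ?_, ?_, ((d₁.seq (d₂.seq d)).congr ?_).mono ?_⟩
  · rw [val_singleton, digit_bit, v₁, v₂]; rfl
  · simp; omega
  · grind [update_apply, h.empty (b + 1) (by omega)]
  · simp; omega

/-- The expression `e₂` is run with a variable that holds the result of `e₁`, so it must be good for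
inputs of `Q + P₁` digits. -/
theorem Expr.Good.sub {e₁ e₂ : Expr} {Q P₁ P₂ : Polynomial ℕ} (x : ℕ) (h₁ : e₁.Good Q P₁)
    (h₂ : e₂.Good (Q + P₁) P₂) : (Expr.sub x e₁ e₂).Good Q (6 + 4 * P₁ + 7 * P₂) := by
  intro w loc b ρ S f h
  obtain ⟨f₁, L₁, v₁, l₁, d₁⟩ := h₁ w loc b ρ S f h
  have h' := (h.push L₁).assign (k := b) (by omega) x (q' := (Q + P₁).eval w.length) (by simp)
    (by simp; omega)
  rw [update_self, v₁] at h'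
  obtain ⟨f₂, L₂, v₂, l₂, d₂⟩ := h₂ w _ (b + 1) _ _ f₁ h'
  have d₃ := does_clear b f₂ (update (update S b L₁) (b + 1) L₂)
  have e1 := h.empty (b + 1) (by omega)
  have e2 := h.empty (b + 2) (by omega)
  -- Two moves, since each of them reverses the digits.
  have d₄ := (does_move (show b + 1 ≠ b + 2 by omega) f₂ (update (update S b []) (b + 1) L₂)).congr
    (show _ = update (update S b []) (b + 2) L₂.reverse by grind [update_apply])
  have d₅ := (does_move (show b + 2 ≠ b by omega) f₂
    (update (update S b []) (b + 2) L₂.reverse)).congr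
    (show _ = update S b L₂ by grind [update_apply])
  refine ⟨f₂, L₂, v₂, ?_, (d₁.seq (d₂.seq ((d₃.congr ?_).seq (d₄.seq d₅)))).mono ?_⟩
  · simp; omega
  · grind [update_apply]
  · simp; omega

/-- Doubling and carry lengthen the accumulator by at most one digit each per symbol, so its length
stays below `2 * w.length + P`, even though its value may be exponential. The summation variable is
a counter that gains at most one digit per increment, which explains `Q + X`. -/
theorem Expr.Good.sum {e : Expr} {Q P : Polynomial ℕ} (s : Γ' → Bool) (dbl : Bool) (x : ℕ)
    (he : e.Good (Q + Polynomial.X) P) : (Expr.sum s dbl x e).Good Q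
      (12 + 12 * Polynomial.X + P + Polynomial.X * (52 + 24 * Polynomial.X + 17 * P)) := by
  intro w loc b ρ S f h
  set N := w.length with hN
  set p := P.eval N with hp
  set g : ℕ → ℕ := fun j => e.eval w (update ρ x j) with hg
  have e0 := h.empty b le_rfl
  have e1 := h.empty (b + 1) (by omega)
  have e2 := h.empty (b + 2) (by omega)
  have e3 := h.empty (b + 3) (by omega)
  have e4 := h.empty (b + 4) (by omega)
  have dc := does_copy (a := 0) (b := b + 2) (c := b + 3) (by simp) (by simp) (by simp) f e2 e3
  rw [h.word] at dc
  obtain ⟨f', S', ⟨l', L, J, h0, hL, hLl, hJ, hJl, rfl⟩, hd⟩ := does_forEach (k := b + 2)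
    (p := .seq (ifX s (.seq (if dbl then put b (.bit false) else .skip)
        (.seq (e.compile (update loc x (b + 1)) (b + 3)) (StackProg.add b (b + 3) (b + 4)))) .skip)
      (.seq (put (b + 3) (.bit true)) (StackProg.add (b + 1) (b + 3) (b + 4))))
    (T := 50 + 24 * N + 17 * p) (f := f) (S := update S (b + 2) w) (l := w)
    -- Here `l'` is the part of the word already read, `L` the accumulator and `J` the counter.
    (fun l f' S' => ∃ l' L J, l' ++ l = w ∧ val L = l'.zipIdx.foldl (sumStep s dbl g) 0 ∧
      L.length ≤ 2 * l'.length + p ∧ val J = l'.length ∧ J.length ≤ l'.length + 1 ∧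
      S' = update (update (update S b L) (b + 1) J) (b + 2) l)
    (by rintro l f' S' ⟨l', L, J, -, -, -, -, -, rfl⟩; simp)
    (by
      rintro a l f' S' ⟨l', L, J, h0, hL, hLl, hJ, hJl, rfl⟩
      have hlen : l'.length + (l.length + 1) = N := by
        have := congrArg List.length h0
        simpa using this
      rw [update_idem]
      -- the counter
      have inc : ∀ f₁ L₁, ∃ f₂ J', val J' = l'.length + 1 ∧ J'.length ≤ l'.length + 2 ∧
          Does (.seq (put (b + 3) (.bit true)) (StackProg.add (b + 1) (b + 3) (b + 4))) f₁
            (update (update (update S b L₁) (b + 1) J) (b + 2) l) f₂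
            (update (update (update S b L₁) (b + 1) J') (b + 2) l) (19 + 8 * N) := by
        intro f₁ L₁
        have d₁ := (does_put (b + 3) (.bit true) f₁
          (update (update (update S b L₁) (b + 1) J) (b + 2) l)).congr
          (show _ = update (update (update (update S b L₁) (b + 1) J) (b + 2) l) (b + 3)
            [.bit true] by grind [update_apply])
        obtain ⟨f₂, J', v, k, d₂⟩ := does_add (a := b + 1) (b := b + 3) (c := b + 4) (by simp)
          (by simp) (by simp) f₁ (S := update (update (update (update S b L₁) (b + 1) J) (b + 2) l)
            (b + 3) [.bit true]) (by simp [e4])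
        have u1 : update (update (update (update S b L₁) (b + 1) J) (b + 2) l) (b + 3)
            [.bit true] (b + 1) = J := by simp
        have u2 : update (update (update (update S b L₁) (b + 1) J) (b + 2) l) (b + 3)
            [.bit true] (b + 3) = [.bit true] := by simp
        rw [u1, u2] at v k d₂
        refine ⟨f₂, J', ?_, ?_, ((d₁.seq d₂).congr ?_).mono ?_⟩
        · rw [v, hJ]; rfl
        · simp at k; omega
        · grind [update_apply]
        · simp at k ⊢; omega
      cases ha : s a
      · obtain ⟨f₂, J', v, k, d⟩ := inc f' L
        refine ⟨f₂, _, ⟨l' ++ [a], L, J', by simp [h0], ?_, ?_, by simp [v], by simp; omega, rfl⟩,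
          ((doesOn_ifX (t := 1) ?_).seq d).mono ?_⟩
        · simp [List.zipIdx_append, hL, sumStep, ha]
        · simp; omega
        · simp only [ha]; exact does_skip _ _
        · omega
      · set L₁ := if dbl then Γ'.bit false :: L else L with hL₁
        have hL₁l : L₁.length ≤ L.length + 1 := by
          rw [hL₁]; split_ifs <;> simp
        have hL₁v : val L₁ = if dbl then 2 * val L else val L := by
          rw [hL₁]; split_ifs
          · simp [val, show digit (.bit false) = 0 from rfl]
          · rfl
        have d₁ : Does (if dbl then put b (.bit false) else .skip) f'
            (update (update (update S b L) (b + 1) J) (b + 2) l) f'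
            (update (update (update S b L₁) (b + 1) J) (b + 2) l) 1 := by
          cases dbl
          · exact does_skip _ _
          · exact (does_put _ _ _ _).congr (by grind [update_apply])
        have hR := (((h.push L₁).push J).push l).assign (k := b + 1) (by omega) x
          (q' := (Q + Polynomial.X).eval N) (by simp [hN]) (by simp; omega)
        have u1 : update (update (update S b L₁) (b + 1) J) (b + 2) l (b + 1) = J := by simp
        have u2 : update (update (update S b L₁) (b + 1) J) (b + 2) l b = L₁ := by simp
        rw [u1] at hR
        obtain ⟨f₁, L₂, v₂, l₂, d₂⟩ := he _ _ _ _ _ f' hR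
        replace l₂ : L₂.length ≤ p := l₂
        obtain ⟨f₂, L₃, v₃, l₃, d₃⟩ := does_add (a := b) (b := b + 3) (c := b + 4) (by simp)
          (by simp) (by simp) f₁ (S := update (update (update (update S b L₁) (b + 1) J) (b + 2) l)
            (b + 3) L₂) (by simp [e4])
        rw [update_self, update_of_ne (by simp : b ≠ b + 3), u2] at v₃ l₃ d₃
        obtain ⟨f₃, J', v, k, d₄⟩ := inc f₂ L₃
        have d₅ : Does (.seq (if dbl then put b (.bit false) else .skip)
            (.seq (e.compile (update loc x (b + 1)) (b + 3)) (StackProg.add b (b + 3) (b + 4)))) f'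
            (update (update (update S b L) (b + 1) J) (b + 2) l) f₂
            (update (update (update S b L₃) (b + 1) J) (b + 2) l)
            (1 + (p + (10 + max L₁.length L₂.length * 8))) :=
          (d₁.seq (d₂.seq d₃)).congr (by grind [update_apply])
        refine ⟨f₃, _, ⟨l' ++ [a], L₃, J', by simp [h0], ?_, ?_, by simp [v], by simp; omega, rfl⟩,
          ((doesOn_ifX (t := 1 + (p + (10 + max L₁.length L₂.length * 8))) ?_).seq d₄).mono ?_⟩
        · rw [v₃, v₂, hL₁v, hJ, hL]
          simp [List.zipIdx_append, sumStep, ha, hg]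
        · rw [List.length_append, List.length_singleton]; omega
        · simp only [ha, if_true]; exact d₅
        · omega)
    ⟨[], [], [], by simp, by simp [val], by simp, by simp [val], by simp,
      by grind [update_apply]⟩
  have dl := does_clear (b + 1) f' (update (update (update S b L) (b + 1) J) (b + 2) [])
  rw [List.append_nil] at h0
  subst h0
  have u1 : update (update (update S b L) (b + 1) J) (b + 2) [] (b + 1) = J := by simp
  rw [u1] at dl
  refine ⟨f', L, hL, ?_, ((dc.seq (hd.seq dl)).congr ?_).mono ?_⟩
  · simp; omega
  · grind [update_apply]
  · simp only [Polynomial.eval_add, Polynomial.eval_mul, Polynomial.eval_ofNat, Polynomial.eval_X,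
      ← hN, ← hp]
    have : N * (50 + 24 * N + 17 * p + 2) = N * (52 + 24 * N + 17 * p) := by ring
    omega

/-- `Q` is quantified inside the induction because subexpressions below a sum or a substitution see
longer variables. -/
theorem Expr.exists_good (e : Expr) : ∀ Q : Polynomial ℕ, ∃ P, e.Good Q P := by
  induction e with
  | bit c => exact fun Q => ⟨_, good_bit c Q⟩
  | var x => exact fun Q => ⟨_, good_var x Q⟩
  | add e₁ e₂ h₁ h₂ =>
    intro Q
    obtain ⟨P₁, h₁⟩ := h₁ Q
    obtain ⟨P₂, h₂⟩ := h₂ Q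
    exact ⟨_, h₁.add h₂⟩
  | mul e₁ e₂ h₁ h₂ =>
    intro Q
    obtain ⟨P₁, h₁⟩ := h₁ Q
    obtain ⟨P₂, h₂⟩ := h₂ Q
    exact ⟨_, h₁.mul h₂⟩
  | lt e₁ e₂ h₁ h₂ =>
    intro Q
    obtain ⟨P₁, h₁⟩ := h₁ Q
    obtain ⟨P₂, h₂⟩ := h₂ Q
    exact ⟨_, h₁.lt h₂⟩
  | sub x e₁ e₂ h₁ h₂ =>
    intro Q
    obtain ⟨P₁, h₁⟩ := h₁ Q
    obtain ⟨P₂, h₂⟩ := h₂ (Q + P₁)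
    exact ⟨_, h₁.sub x h₂⟩
  | sum s dbl x e h =>
    intro Q
    obtain ⟨P, h⟩ := h (Q + Polynomial.X)
    exact ⟨_, h.sum s dbl x⟩

/-- Languages that are defined by arithmetical expressions are in P. -/
theorem inP_of_expr {L : Language Γ'} (e : Expr) (h : ∀ w, e.eval w 0 ≠ 0 ↔ w ∈ L) : InP L := by
  obtain ⟨P, hP⟩ := e.exists_good 0
  -- All variables are initially zero, being located at the empty stack `1`, so the bound `0` on
  -- their lengths suffices. Clearing the word and testing the result leave all stacks empty.
  refine inP_of_prog (.seq (e.compile (fun _ => 1) 2) (.seq (clear 0) (test 2)))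
    (false, none, none) (fun v => v.1) (5 + 3 * Polynomial.X + 4 * P) fun w => ?_
  have hR : Represents w (fun _ => 1) 2 0 (Polynomial.eval w.length 0)
      (update (fun _ => []) 0 w) :=
    ⟨by simp, by simp, by simp, by simp [val], by simp, fun j hj => by
      rw [update_of_ne (by omega)]⟩
  obtain ⟨f', L', v, l, d⟩ := hP w _ _ _ _ false hR
  have d' := d.seq ((does_clear 0 _ _).seq (does_test 2 _ _))
  obtain ⟨r', t', ht', hr⟩ := d' (none, none)
  refine ⟨(decide (val L' ≠ 0), r'), t', ht'.trans ?_, ?_, ?_⟩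
  · simp; omega
  · convert hr using 1
    · grind [update_apply]
    · funext j
      grind [update_apply]
  · rw [← h, ← v]
    simp

end StackProg

/-! ## Best responses and equilibria -/

namespace QV

open Function Finset

variable {n m : ℕ}

/-- The outcomes with the highest value. -/
def argmax (τ : Fin m → ℤ) : Finset (Fin m) := univ.filter fun ω => ∀ φ, τ φ ≤ τ ω

/-- The mean utility of the outcomes in `W`, minus the price of votes with square sum `c`. -/
noncomputable def payoff (α : ℝ) (u : Fin m → ℤ) (W : Finset (Fin m)) (c : ℤ) : ℝ :=
  (∑ ω ∈ W, (u ω : ℝ)) / W.card - α * c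

/-- The sum of the squares of the votes. -/
def cost (σ : Fin m → ℤ) : ℤ := ∑ ω, σ ω ^ 2

/-- The strategy `x` is a best response to the total votes `S` of the other agents. -/
def IsBest (α : ℝ) (u S x : Fin m → ℤ) : Prop :=
  ∀ σ, payoff α u (argmax (S + σ)) (cost σ) ≤ payoff α u (argmax (S + x)) (cost x)

/-- The total votes of the agents other than `i`. -/
def others (v : Fin n → Fin m → ℤ) (i : Fin n) : Fin m → ℤ := fun ω => totalVotes v ω - v i ω

theorem others_eq_sum (v : Fin n → Fin m → ℤ) (i : Fin n) (ω : Fin m) :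
    others v i ω = ∑ j ∈ univ.erase i, v j ω := by
  rw [others, totalVotes, ← add_sum_erase univ _ (mem_univ i)]
  ring

theorem others_add_self (v : Fin n → Fin m → ℤ) (i : Fin n) : others v i + v i = totalVotes v := by
  funext ω; simp [others]

theorem totalVotes_update (v : Fin n → Fin m → ℤ) (i : Fin n) (σ : Fin m → ℤ) :
    totalVotes (update v i σ) = others v i + σ := by
  funext ω
  rw [Pi.add_apply, others_eq_sum, totalVotes, ← add_sum_erase univ _ (mem_univ i), update_self,
    add_comm]
  congr 1
  refine sum_congr rfl fun j hj => ?_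
  rw [update_of_ne (ne_of_mem_erase hj)]

/-- The refund depends on the other agents' votes only, hence it is a constant that cancels when
strategies of `i` are compared. -/
theorem totalUtility_update (α : ℝ) (u v : Fin n → Fin m → ℤ) (i : Fin n) (σ : Fin m → ℤ) :
    totalUtility α (fun i ω => (u i ω : ℝ)) i (update v i σ) =
      payoff α (u i) (argmax (others v i + σ)) (cost σ)
      + α / ((Fintype.card (Fin n) : ℝ) - 1) * ∑ j ∈ univ.erase i, ∑ ω, (v j ω : ℝ) ^ 2 := by
  have hw : winners (update v i σ) = argmax (others v i + σ) := by
    rw [← totalVotes_update]; ext; simp [winners, argmax]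
  rw [totalUtility, payoff, update_self, cost]
  congr 1
  · congr 1
    · simp only [winProb, hw, mul_ite, mul_zero]
      rw [sum_ite_mem, univ_inter, sum_div]
      exact sum_congr rfl fun ω _ => by ring
    · push_cast; rfl
  · congr 1
    refine sum_congr rfl fun j hj => ?_
    rw [update_of_ne (ne_of_mem_erase hj)]

theorem isPureNash_iff (α : ℝ) (u v : Fin n → Fin m → ℤ) :
    IsPureNash α (fun i ω => (u i ω : ℝ)) v ↔ ∀ i, IsBest α (u i) (others v i) (v i) := by
  refine forall_congr' fun i => forall_congr' fun σ => ?_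
  conv_lhs => rhs; rw [← update_eq_self i v]
  rw [totalUtility_update, totalUtility_update, add_le_add_iff_right]

theorem argmax_eq {τ : Fin m → ℤ} {W : Finset (Fin m)} (hW : W.Nonempty) (t : ℤ)
    (h₁ : ∀ ω ∈ W, τ ω = t) (h₂ : ∀ ω ∉ W, τ ω < t) : argmax τ = W := by
  obtain ⟨a, ha⟩ := hW
  ext ω
  simp only [argmax, mem_filter, mem_univ, true_and]
  constructor
  · intro h
    by_contra hω
    have := h a
    have := h₁ a ha
    have := h₂ ω hω
    omega
  · intro hω φ
    rw [h₁ ω hω]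
    by_cases hφ : φ ∈ W
    · exact (h₁ φ hφ).le
    · exact (h₂ φ hφ).le

theorem exists_argmax (a : Fin m) (τ : Fin m → ℤ) : (argmax τ).Nonempty ∧
    ∃ t, (∀ ω ∈ argmax τ, τ ω = t) ∧ ∀ ω ∉ argmax τ, τ ω < t := by
  obtain ⟨b, -, hb⟩ := exists_max_image univ τ ⟨a, mem_univ a⟩
  have hb' : b ∈ argmax τ := by simpa [argmax] using hb
  refine ⟨⟨b, hb'⟩, τ b, fun ω hω => ?_, fun ω hω => ?_⟩
  · simp only [argmax, mem_filter, mem_univ, true_and] at hω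
    exact le_antisymm (hb ω (mem_univ ω)) (hω b)
  · refine lt_of_le_of_ne (hb ω (mem_univ ω)) fun h => hω ?_
    simp only [argmax, mem_filter, mem_univ, true_and]
    exact fun φ => h ▸ hb φ (mem_univ φ)

theorem cost_update (x : Fin m → ℤ) (a : Fin m) (y : ℤ) :
    cost (update x a y) = cost x - x a ^ 2 + y ^ 2 := by
  rw [cost, cost, ← add_sum_erase univ _ (mem_univ a),
    ← add_sum_erase univ (fun ω => x ω ^ 2) (mem_univ a), update_self,
    sum_congr rfl fun ω hω => by rw [update_of_ne (ne_of_mem_erase hω)]]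
  ring

theorem add_update_apply (S x : Fin m → ℤ) (a : Fin m) (y : ℤ) (ω : Fin m) :
    (S + update x a y) ω = if ω = a then (S + x) a + (y - x a) else (S + x) ω := by
  split_ifs with h
  · subst h; simp
  · simp [h]

/-! ### Consequences of the optimality of a strategy -/

section IsBest

variable {α : ℝ} {u S x : Fin m → ℤ} {t : ℤ}

/-- The same outcome cannot be reached at a lower price. -/
theorem IsBest.cost_le (hα : 0 < α) (h : IsBest α u S x) {σ : Fin m → ℤ}
    (hσ : argmax (S + σ) = argmax (S + x)) : cost x ≤ cost σ := by
  have := h σ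
  rw [hσ, payoff, payoff] at this
  have h2 : α * (cost x : ℝ) ≤ α * cost σ := by linarith
  exact_mod_cast le_of_mul_le_mul_left h2 hα

/-- Otherwise withdrawing the votes for the loser `a` would be cheaper and keep the winners. -/
theorem IsBest.nonpos {a : Fin m} (hα : 0 < α) (h : IsBest α u S x)
    (h₁ : ∀ ω ∈ argmax (S + x), (S + x) ω = t)
    (h₂ : ∀ ω ∉ argmax (S + x), (S + x) ω < t)
    (ha : a ∉ argmax (S + x)) : x a ≤ 0 := by
  by_contra! hx
  have hW := (exists_argmax a (S + x)).1
  have := h.cost_le hα (σ := update x a 0) (argmax_eq hW t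
    (fun ω hω => by
      rw [add_update_apply, if_neg (by rintro rfl; exact ha hω), h₁ ω hω])
    (fun ω hω => by
      rw [add_update_apply]; split_ifs with hωa
      · have := h₂ a ha; omega
      · exact h₂ ω hω))
  rw [cost_update] at this
  nlinarith

/-- Otherwise `a` would still lose with one negative vote less. -/
theorem IsBest.eq_of_neg {a : Fin m} (hα : 0 < α) (h : IsBest α u S x)
    (h₁ : ∀ ω ∈ argmax (S + x), (S + x) ω = t)
    (h₂ : ∀ ω ∉ argmax (S + x), (S + x) ω < t)
    (ha : a ∉ argmax (S + x)) (hx : x a < 0) :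
    (S + x) a = t - 1 := by
  by_contra hne
  have hW := (exists_argmax a (S + x)).1
  have := h.cost_le hα (σ := update x a (x a + 1)) (argmax_eq hW t
    (fun ω hω => by
      rw [add_update_apply, if_neg (by rintro rfl; exact ha hω), h₁ ω hω])
    (fun ω hω => by
      rw [add_update_apply]; split_ifs with hωa
      · have := h₂ a ha; omega
      · exact h₂ ω hω))
  rw [cost_update] at this
  nlinarith

/-- Otherwise one negative vote less would be cheaper and only increase the lead of `a`. -/
theorem IsBest.nonneg_of_unique {a : Fin m} (hα : 0 < α) (h : IsBest α u S x)
    (h₁ : ∀ ω ∈ argmax (S + x), (S + x) ω = t)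
    (h₂ : ∀ ω ∉ argmax (S + x), (S + x) ω < t)
    (ha : argmax (S + x) = {a}) : 0 ≤ x a := by
  by_contra! hx
  have ht := h₁ a (by simp [ha])
  have := h.cost_le hα (σ := update x a (x a + 1)) (by
    rw [ha]
    refine argmax_eq (singleton_nonempty a) (t + 1) (fun ω hω => ?_) (fun ω hω => ?_)
    · rw [mem_singleton] at hω
      rw [add_update_apply, if_pos hω, ht]; ring
    · have := h₂ ω (by rwa [ha])
      rw [mem_singleton] at hω
      rw [add_update_apply, if_neg hω]; omega)
  rw [cost_update] at this
  nlinarith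

/-- With a lead of at least two, `a` still wins alone after losing one vote, so a positive vote
would be wasteful. -/
theorem IsBest.nonpos_of_unique {a : Fin m} (hα : 0 < α) (h : IsBest α u S x)
    (h₁ : ∀ ω ∈ argmax (S + x), (S + x) ω = t)
    (ha : argmax (S + x) = {a})
    (hlt : ∀ ω, ω ≠ a → (S + x) ω < t - 1) : x a ≤ 0 := by
  by_contra! hx
  have ht := h₁ a (by simp [ha])
  have := h.cost_le hα (σ := update x a (x a - 1)) (by
    rw [ha]
    refine argmax_eq (singleton_nonempty a) (t - 1) (fun ω hω => ?_) (fun ω hω => ?_)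
    · rw [mem_singleton] at hω
      rw [add_update_apply, if_pos hω, ht]; ring
    · rw [mem_singleton] at hω
      rw [add_update_apply, if_neg hω]; exact hlt ω hω)
  rw [cost_update] at this
  nlinarith

/-- Two deviations are played off against each other. Let `g` be the excess of the utility of `a`
over the mean of the tied winners. One more vote makes `a` the only winner, so `g` is at most `α *
(2 * x a + 1)`. Withdrawing all votes removes `a` from the winners, so `α * x a ^ 2` is at most `g /
(k - 1)`. Together `x a ^ 2 ≤ 2 * x a + 1`, which fails from `3` on. -/
theorem IsBest.le_two {a : Fin m} (hα : 0 < α) (h : IsBest α u S x)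
    (h₁ : ∀ ω ∈ argmax (S + x), (S + x) ω = t)
    (h₂ : ∀ ω ∉ argmax (S + x), (S + x) ω < t)
    (ha : a ∈ argmax (S + x)) (hk : 2 ≤ (argmax (S + x)).card) :
    x a ≤ 2 := by
  by_contra! hx
  set W := argmax (S + x) with hW
  have ht := h₁ a ha
  have e1 : argmax (S + update x a (x a + 1)) = {a} := by
    refine argmax_eq (singleton_nonempty a) (t + 1) (fun ω hω => ?_) (fun ω hω => ?_)
    · rw [mem_singleton] at hω
      rw [add_update_apply, if_pos hω, ht]; ring
    · rw [mem_singleton] at hω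
      rw [add_update_apply, if_neg hω]
      by_cases hωW : ω ∈ W
      · rw [h₁ ω hωW]; omega
      · have := h₂ ω hωW; omega
  have hcard : (W.erase a).card = W.card - 1 := card_erase_of_mem ha
  have e2 : argmax (S + update x a 0) = W.erase a := by
    refine argmax_eq (card_pos.1 (by omega)) t (fun ω hω => ?_) (fun ω hω => ?_)
    · rw [add_update_apply, if_neg (ne_of_mem_erase hω), h₁ ω (mem_of_mem_erase hω)]
    · rw [add_update_apply]; split_ifs with hωa
      · rw [ht]; omega
      · exact h₂ ω fun h => hω (mem_erase.2 ⟨hωa, h⟩)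
  have i1 := h (update x a (x a + 1))
  have i2 := h (update x a 0)
  rw [e1, ← hW, payoff, payoff, cost_update, sum_singleton, card_singleton] at i1
  rw [e2, ← hW, payoff, payoff, cost_update, hcard, sum_erase_eq_sub ha,
    Nat.cast_sub (by omega)] at i2
  push_cast at i1 i2
  set k : ℝ := ((W.card : ℕ) : ℝ) with hk'
  have hk2 : (2 : ℝ) ≤ k := by rw [hk']; exact_mod_cast hk
  set s := ∑ ω ∈ W, (u ω : ℝ)
  set g : ℝ := u a - s / k with hg
  -- The mean utility of the winners other than `a`, in terms of `g`.
  have e3 : (s - u a) / (k - 1) = s / k - g / (k - 1) := by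
    rw [hg]; field_simp [show k ≠ 0 by linarith, show k - 1 ≠ 0 by linarith]; ring
  have i3 : g ≤ α * (2 * x a + 1) := by rw [hg]; nlinarith
  have i4 : α * (x a : ℝ) ^ 2 ≤ g / (k - 1) := by rw [e3] at i2; nlinarith
  have hx' : (3 : ℝ) ≤ x a := by exact_mod_cast hx
  have i5 : g / (k - 1) ≤ α * (2 * x a + 1) := by
    rw [div_le_iff₀ (by linarith)]
    refine i3.trans (le_mul_of_one_le_right (by positivity) (by linarith))
  have i6 : (x a : ℝ) ^ 2 ≤ 2 * x a + 1 := le_of_mul_le_mul_left (i4.trans i5) hα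
  nlinarith

/-- One more vote for every outcome keeps the winners and changes the sum of squares by `2 * ∑ ω, x
ω + m`, which must not be negative. -/
theorem IsBest.lt_sum (hα : 0 < α) (h : IsBest α u S x)
    (h₁ : ∀ ω ∈ argmax (S + x), (S + x) ω = t)
    (h₂ : ∀ ω ∉ argmax (S + x), (S + x) ω < t)
    (a : Fin m) : -(m : ℤ) < ∑ ω, x ω := by
  by_contra! hs
  have := h.cost_le hα (σ := x + 1) (argmax_eq (exists_argmax a (S + x)).1 (t + 1)
    (fun ω hω => by rw [← h₁ ω hω]; simp [add_assoc])
    (fun ω hω => by have := h₂ ω hω; simp at this ⊢; omega))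
  have e : cost (x + 1) = cost x + 2 * ∑ ω, x ω + m := by
    simp only [cost, Pi.add_apply, Pi.one_apply, add_sq, sum_add_distrib, mul_sum]
    simp
  have : 0 < m := a.pos
  omega

end IsBest

/-! ### A bound for the votes in an equilibrium -/

/-- In an equilibrium, the total votes of all but one agents are small. -/
theorem abs_others_le {α : ℝ} (hα : 0 < α) {u v : Fin n → Fin m → ℤ}
    (h : ∀ i, IsBest α (u i) (others v i) (v i)) (i : Fin n) (a : Fin m) :
    |others v i a| ≤ 2 * n + 1 := by
  obtain ⟨hW, t, h₁, h₂⟩ := exists_argmax a (totalVotes v)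
  set T := totalVotes v with hT
  have hS : ∀ i, others v i + v i = T := others_add_self v
  have hTa : others v i a = T a - v i a := rfl
  have b := fun i {a} => (h i).nonpos (a := a) hα (t := t) (by rwa [hS]) (by rwa [hS])
  have c := fun i {a} => (h i).eq_of_neg (a := a) hα (t := t) (by rwa [hS]) (by rwa [hS])
  have d := fun i {a} => (h i).nonneg_of_unique (a := a) hα (t := t) (by rwa [hS]) (by rwa [hS])
  have e := fun i {a} => (h i).nonpos_of_unique (a := a) hα (t := t) (by rwa [hS])
  have f := fun i {a} => (h i).le_two (a := a) hα (t := t) (by rwa [hS]) (by rwa [hS])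
  have g := fun i => (h i).lt_sum hα (t := t) (by rwa [hS]) (by rwa [hS]) a
  simp only [hS] at b c d e f
  have hn : 0 < n := i.pos
  have hm : 0 < m := a.pos
  have hle : ∀ ω, T ω ≤ t := fun ω => by
    by_cases hω : ω ∈ argmax T
    · exact (h₁ ω hω).le
    · exact (h₂ ω hω).le
  -- a lower bound for the highest total
  have ht : -(n : ℤ) < t := by
    have h3 : ∑ i, ∑ ω, v i ω ≤ m * t := by
      rw [sum_comm]
      calc ∑ ω, ∑ i, v i ω ≤ ∑ _ω : Fin m, t := sum_le_sum fun ω _ => hle ω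
        _ = m * t := by simp
    have h4 : ∑ _i : Fin n, -(m : ℤ) < ∑ i, ∑ ω, v i ω :=
      sum_lt_sum_of_nonempty ⟨i, mem_univ i⟩ fun i _ => g i
    simp only [sum_neg_distrib, sum_const, card_univ, Fintype.card_fin, nsmul_eq_mul] at h4
    have : (m : ℤ) * -n < m * t := by linarith
    exact lt_of_mul_lt_mul_left this (by positivity)
  have hlos : ∀ ω ∉ argmax T, T ω ≤ 0 := fun ω hω => sum_nonpos fun i _ => b i hω
  rw [abs_le]
  by_cases ha : a ∈ argmax T
  · have hta := h₁ a ha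
    by_cases hk : 2 ≤ (argmax T).card
    · have h5 : others v i a ≤ 2 * n := by
        rw [others_eq_sum]
        calc ∑ j ∈ univ.erase i, v j a ≤ ∑ _j ∈ univ.erase i, 2 := sum_le_sum fun j _ => f j ha hk
          _ ≤ 2 * n := by simp [card_erase_of_mem]; omega
      have := f i ha hk
      omega
    · have hk1 : (argmax T).card = 1 := by
        have := card_pos.2 hW; omega
      obtain ⟨a', ha'⟩ := card_eq_one.1 hk1
      obtain rfl : a = a' := by simpa [ha'] using ha
      -- All losers have totals at most `0`, so for `t ≥ 2` they trail by at least two; then nobody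
      -- casts positive votes for `a`, and `T a = t` is impossible.
      have ht1 : t ≤ 1 := by
        by_contra! ht1
        have h6 : T a ≤ 0 := sum_nonpos fun i _ => e i ha' fun ω hω => by
          have := hlos ω (by simpa [ha'] using hω)
          omega
        omega
      have h7 : 0 ≤ others v i a := by
        rw [others_eq_sum]; exact sum_nonneg fun j _ => d j ha'
      have := d i ha'
      omega
  · have h8 : others v i a ≤ 0 := by
      rw [others_eq_sum]; exact sum_nonpos fun j _ => b j ha
    -- Either some agent votes against `a`, which pins its total to `t - 1`, or nobody does.
    have h9 : -(n : ℤ) ≤ T a := by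
      by_cases hj : ∃ j, v j a < 0
      · obtain ⟨j, hj⟩ := hj
        have := c j ha hj
        omega
      · push Not at hj
        have : 0 ≤ T a := sum_nonneg fun j _ => hj j
        omega
    have := b i ha
    omega

/-! ### Best responses that are determined by a threshold -/

/-- The cheapest votes for `ω` such that, in view of the votes `S` of the other agents, the total is
less than `t`. -/
def lowVote (S : Fin m → ℤ) (t : ℤ) (ω : Fin m) : ℤ := min 0 (t - 1 - S ω)

/-- The cheapest strategy such that, in view of the votes `S` of the other agents, the outcomes in
`W` win with `t` votes. -/
def dev (S : Fin m → ℤ) (t : ℤ) (W : Finset (Fin m)) : Fin m → ℤ :=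
  fun ω => if ω ∈ W then t - S ω else lowVote S t ω

theorem argmax_dev (S : Fin m → ℤ) (t : ℤ) {W : Finset (Fin m)} (hW : W.Nonempty) :
    argmax (S + dev S t W) = W :=
  argmax_eq hW t (fun ω hω => by simp [dev, hω]) (fun ω hω => by
    simp only [dev, lowVote, hω, if_false, Pi.add_apply]; omega)

theorem sq_le_sq_of_le {x y : ℤ} (h : 0 ≤ x ∧ x ≤ y ∨ y ≤ x ∧ x ≤ 0) : x ^ 2 ≤ y ^ 2 := by
  rcases h with h | h <;> nlinarith

/-- The votes for a winner are forced by `t`. For a loser every admissible number of votes is at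
most `t - 1 - S ω`, and `lowVote` is the admissible number closest to zero. -/
theorem cost_dev_le (S σ : Fin m → ℤ) {t : ℤ} (h₁ : ∀ ω ∈ argmax (S + σ), (S + σ) ω = t)
    (h₂ : ∀ ω ∉ argmax (S + σ), (S + σ) ω < t) : cost (dev S t (argmax (S + σ))) ≤ cost σ := by
  refine sum_le_sum fun ω _ => ?_
  rw [dev]
  split_ifs with hω
  · have := h₁ ω hω
    rw [Pi.add_apply] at this
    rw [← this, add_sub_cancel_left]
  · have := h₂ ω hω
    rw [Pi.add_apply] at this
    refine sq_le_sq_of_le ?_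
    rw [lowVote]; omega

/-- Clamp `t` to the interval. Above `B + 1`, winners need positive votes and losers none, so
lowering `t` only saves; below `-B`, all votes are negative and raising `t` brings them closer to
zero. -/
theorem exists_cost_dev_le (S : Fin m → ℤ) {B : ℤ} (hS : ∀ ω, |S ω| ≤ B) (t : ℤ)
    (W : Finset (Fin m)) (hB : 0 ≤ B) :
    ∃ t', -B ≤ t' ∧ t' ≤ B + 1 ∧ cost (dev S t' W) ≤ cost (dev S t W) := by
  refine ⟨max (-B) (min t (B + 1)), by omega, by omega, sum_le_sum fun ω _ => sq_le_sq_of_le ?_⟩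
  have := abs_le.1 (hS ω)
  rw [dev, dev, lowVote, lowVote]
  split_ifs <;> omega

/-- The price of including `ω` in the set of winners. -/
def extraCost (S : Fin m → ℤ) (t : ℤ) (ω : Fin m) : ℤ := (t - S ω) ^ 2 - lowVote S t ω ^ 2

/-- For fixed `t` the cost is a constant plus a sum over `W`. This additivity reduces the choice of
`W` to sorting. -/
theorem cost_dev (S : Fin m → ℤ) (t : ℤ) (W : Finset (Fin m)) :
    cost (dev S t W) = ∑ ω, lowVote S t ω ^ 2 + ∑ ω ∈ W, extraCost S t ω := by
  rw [cost, ← sum_filter_add_sum_filter_not univ (· ∈ W), ← sum_filter_add_sum_filter_not univ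
    (· ∈ W) (fun ω => lowVote S t ω ^ 2), filter_mem_eq_inter, univ_inter]
  have e1 : ∑ ω ∈ W, dev S t W ω ^ 2 = ∑ ω ∈ W, lowVote S t ω ^ 2 + ∑ ω ∈ W, extraCost S t ω := by
    rw [← sum_add_distrib]
    refine sum_congr rfl fun ω hω => ?_
    simp [dev, hω, extraCost]
  have e2 : ∑ ω ∈ univ with ω ∉ W, dev S t W ω ^ 2 = ∑ ω ∈ univ with ω ∉ W, lowVote S t ω ^ 2 := by
    refine sum_congr rfl fun ω hω => ?_
    rw [mem_filter] at hω
    simp [dev, hω.2]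
  rw [e1, e2]
  ring

/-! ### The best set of winners of a given size -/

/-- The outcomes with an integer key at least as high as the key of `φ`. -/
def upper (key : Fin m → ℤ) (φ : Fin m) : Finset (Fin m) := univ.filter fun ω => key φ ≤ key ω

theorem upper_nonempty (key : Fin m → ℤ) (φ : Fin m) : (upper key φ).Nonempty :=
  ⟨φ, by simp [upper]⟩

/-- Upper sets are nested, and distinct outcomes have distinct ones, so their sizes are `m`
different numbers in `Icc 1 m`, that is, all of them. -/
theorem exists_card_upper_eq {key : Fin m → ℤ} (hkey : Injective key) {k : ℕ} (h1 : 1 ≤ k)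
    (h2 : k ≤ m) : ∃ φ, (upper key φ).card = k := by
  have hinj : Set.InjOn (fun φ => (upper key φ).card) (univ : Finset (Fin m)) := by
    intro φ _ ψ _ h
    wlog hle : key φ ≤ key ψ generalizing φ ψ
    · exact (this (mem_univ _) (mem_univ _) h.symm (by omega)).symm
    have hsub : upper key ψ ⊆ upper key φ := by
      intro ω hω
      simp only [upper, mem_filter, mem_univ, true_and] at hω ⊢
      omega
    have heq := eq_of_subset_of_card_le hsub h.le
    have : φ ∈ upper key ψ := by rw [heq]; simp [upper]
    simp only [upper, mem_filter, mem_univ, true_and] at this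
    exact hkey (by omega)
  have himg : univ.image (fun φ => (upper key φ).card) = Icc 1 m := by
    refine eq_of_subset_of_card_le ?_ ?_
    · intro c hc
      obtain ⟨φ, -, rfl⟩ := mem_image.1 hc
      have := card_pos.2 (upper_nonempty key φ)
      have := card_le_univ (upper key φ)
      simp only [Fintype.card_fin] at this
      exact mem_Icc.2 ⟨by omega, this⟩
    · rw [card_image_of_injOn hinj]; simp
  have : k ∈ univ.image (fun φ => (upper key φ).card) := by rw [himg]; exact mem_Icc.2 ⟨h1, h2⟩
  obtain ⟨φ, -, hφ⟩ := mem_image.1 this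
  exact ⟨φ, hφ⟩

/-- A key that orders the outcomes by `val`, and by number if the values are equal. -/
def lexKey (val : Fin m → ℤ) (ω : Fin m) : ℤ := m * val ω + ω

/-- Outcome numbers differ by less than `m`, so they cannot outweigh a difference in `val`. -/
theorem le_of_lexKey_le {val : Fin m → ℤ} {φ ω : Fin m} (h : lexKey val φ ≤ lexKey val ω) :
    val φ ≤ val ω := by
  by_contra! hlt
  have := φ.2
  have := ω.2
  rw [lexKey, lexKey] at h
  nlinarith

theorem lexKey_injective (val : Fin m → ℤ) : Injective (lexKey val) := by
  intro φ ω h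
  have h1 := le_antisymm (le_of_lexKey_le h.le) (le_of_lexKey_le h.ge)
  rw [lexKey, lexKey, h1] at h
  exact Fin.ext (by omega)

/-- Exchange argument: relative to `val φ`, members of the upper set have nonnegative value and all
other outcomes nonpositive value; as the two sets have the same size, the shift by `val φ` does not
matter. -/
theorem exists_upper_lexKey (val : Fin m → ℤ) {W : Finset (Fin m)} (hW : W.Nonempty) :
    ∃ φ, (upper (lexKey val) φ).card = W.card ∧
      ∑ ω ∈ W, val ω ≤ ∑ ω ∈ upper (lexKey val) φ, val ω := by
  obtain ⟨φ, hφ⟩ := exists_card_upper_eq (lexKey_injective val) (card_pos.2 hW)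
    (by simpa using card_le_univ W)
  refine ⟨φ, hφ, ?_⟩
  set U := upper (lexKey val) φ with hU
  have h1 : ∀ ω ∈ U, 0 ≤ val ω - val φ := fun ω hω => by
    simp only [hU, upper, mem_filter, mem_univ, true_and] at hω
    exact sub_nonneg.2 (le_of_lexKey_le hω)
  have h2 : ∀ ω ∉ U, val ω - val φ ≤ 0 := fun ω hω => by
    simp only [hU, upper, mem_filter, mem_univ, true_and, not_le] at hω
    exact sub_nonpos.2 (le_of_lexKey_le hω.le)
  have h3 : ∑ ω ∈ W, (val ω - val φ) ≤ ∑ ω ∈ U, (val ω - val φ) :=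
    calc ∑ ω ∈ W, (val ω - val φ)
        = ∑ ω ∈ W with ω ∈ U, (val ω - val φ) + ∑ ω ∈ W with ω ∉ U, (val ω - val φ) :=
          (sum_filter_add_sum_filter_not _ _ _).symm
      _ ≤ ∑ ω ∈ W with ω ∈ U, (val ω - val φ) + 0 := by
          gcongr
          exact sum_nonpos fun ω hω => h2 ω (mem_filter.1 hω).2
      _ ≤ ∑ ω ∈ U, (val ω - val φ) := by
          rw [add_zero]
          exact sum_le_sum_of_subset_of_nonneg (fun ω hω => (mem_filter.1 hω).2)
            fun ω hω _ => h1 ω hω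
  simp only [sum_sub_distrib, sum_const, nsmul_eq_mul, hφ] at h3
  linarith

/-- The value of `ω` as one of `k` winners with `t` votes, for the price constant `p / q`. -/
def winValue (p q : ℕ) (u S : Fin m → ℤ) (t : ℤ) (k : ℕ) (ω : Fin m) : ℤ :=
  q * u ω - p * k * extraCost S t ω

/-- The set of `k` winners that is best for an agent, for suitable `φ`. -/
def bestSet (p q : ℕ) (u S : Fin m → ℤ) (t : ℤ) (k : ℕ) (φ : Fin m) : Finset (Fin m) :=
  upper (lexKey (winValue p q u S t k)) φ

/-- For sets of `k` winners with `t` votes, the payoff is the sum of `winValue` divided by `q * k`,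
up to a term that does not depend on the set. -/
theorem exists_bestSet {p q : ℕ} (hq : 0 < q) (u S : Fin m → ℤ) (t : ℤ) {W : Finset (Fin m)}
    (hW : W.Nonempty) : ∃ φ, payoff (p / q : ℝ) u W (cost (dev S t W)) ≤
      payoff (p / q : ℝ) u (bestSet p q u S t W.card φ)
        (cost (dev S t (bestSet p q u S t W.card φ))) := by
  obtain ⟨φ, h1, h2⟩ := exists_upper_lexKey (winValue p q u S t W.card) hW
  refine ⟨φ, ?_⟩
  change (bestSet p q u S t W.card φ).card = W.card at h1
  change _ ≤ ∑ ω ∈ bestSet p q u S t W.card φ, _ at h2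
  have hk : (0 : ℝ) < ((W.card : ℕ) : ℝ) := by exact_mod_cast card_pos.2 hW
  have hq' : (0 : ℝ) < q := by exact_mod_cast hq
  have key : ∀ V : Finset (Fin m), V.card = W.card → payoff (p / q : ℝ) u V (cost (dev S t V))
      = ((∑ ω ∈ V, winValue p q u S t W.card ω : ℤ) : ℝ) / (q * ((W.card : ℕ) : ℝ))
        - p / q * ((∑ ω, lowVote S t ω ^ 2 : ℤ) : ℝ) := by
    intro V hV
    rw [payoff, cost_dev, hV]
    simp only [winValue, sum_sub_distrib, ← mul_sum]
    push_cast
    field_simp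
    ring
  rw [key W rfl, key _ h1]
  gcongr

/-- Best responses can be recognized by means of finitely many alternatives. -/
theorem isBest_iff {p q : ℕ} (hq : 0 < q) {u S x : Fin m → ℤ} {B : ℤ} (hB : 0 ≤ B)
    (hS : ∀ ω, |S ω| ≤ B) : IsBest (p / q : ℝ) u S x ↔
      ∀ t : ℤ, -B ≤ t → t ≤ B + 1 → ∀ k ≤ m, ∀ φ,
        payoff (p / q : ℝ) u (bestSet p q u S t k φ) (cost (dev S t (bestSet p q u S t k φ))) ≤
          payoff (p / q : ℝ) u (argmax (S + x)) (cost x) := by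
  constructor
  -- Each alternative is a genuine strategy whose winners are exactly `bestSet`, even if that set
  -- does not have `k` elements.
  · intro h t _ _ k _ φ
    have := h (dev S t (bestSet p q u S t k φ))
    rwa [argmax_dev S t (W := bestSet p q u S t k φ) (upper_nonempty _ _)] at this
  · intro h σ
    rcases Nat.eq_zero_or_pos m with rfl | hm
    · have : σ = x := Subsingleton.elim _ _
      rw [this]
    -- Keep the winners of `σ`, make the votes cheapest for its threshold, clamp the threshold, and
    -- finally replace the winners by the best set of the same size.
    obtain ⟨hW, t, h₁, h₂⟩ := exists_argmax ⟨0, hm⟩ (S + σ)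
    obtain ⟨t', ht1, ht2, hc⟩ := exists_cost_dev_le S hS t (argmax (S + σ)) hB
    obtain ⟨φ, hφ⟩ := exists_bestSet (p := p) hq u S t' hW
    refine le_trans ?_ (hφ.trans (h t' ht1 ht2 _ (by simpa using card_le_univ (argmax (S + σ))) φ))
    have h3 := hc.trans (cost_dev_le S σ h₁ h₂)
    have h4 : ((cost (dev S t' (argmax (S + σ))) : ℤ) : ℝ) ≤ cost σ := by exact_mod_cast h3
    rw [payoff, payoff]
    gcongr

end QV

/-! ## Words as sequences of tokens -/

namespace QV

open Computability

/-- The number of commas before position `q`. -/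
def commas (w : List Γ') (q : ℕ) : ℕ := (w.take q).count Γ'.comma

/-- The number of positions before `q` in the same token. -/
def offset (w : List Γ') (q : ℕ) : ℕ :=
  ((List.range q).filter fun r => commas w r = commas w q).length

/-- Annotate each symbol with the number of its token and its position in the token, starting with
token `c` at position `p`. -/
def annotate : List Γ' → ℕ → ℕ → List (Γ' × ℕ × ℕ)
  | [], _, _ => []
  | a :: l, c, p => (a, c, p) :: if a = Γ'.comma then annotate l (c + 1) 0 else annotate l c (p + 1)

theorem commas_mono (w : List Γ') {q r : ℕ} (h : q ≤ r) : commas w q ≤ commas w r :=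
  (List.take_sublist_take_left h).count_le _

theorem commas_append_length (l l' : List Γ') : commas (l ++ l') l.length = l.count .comma := by
  simp [commas]

/-- This links the description by positions, which arithmetical expressions can compute, to the
recursive one, which suits inductions over tokens. -/
theorem map_zipIdx_eq_annotate (w : List Γ') :
    w.zipIdx.map (fun p => (p.1, commas w p.2, offset w p.2)) = annotate w 0 0 := by
  have key : ∀ l pre : List Γ', w = pre ++ l →
      (l.zipIdx pre.length).map (fun p => (p.1, commas w p.2, offset w p.2))
        = annotate l (commas w pre.length) (offset w pre.length) := by
    intro l
    induction l with
    | nil => intro pre _; rfl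
    | cons a l ih =>
      intro pre h
      have h' := ih (pre ++ [a]) (by simp [h])
      rw [List.length_append, List.length_singleton] at h'
      rw [List.zipIdx_cons, List.map_cons, h', annotate]
      congr 1
      have hc : commas w (pre.length + 1) = pre.count .comma + [a].count .comma := by
        have := commas_append_length (pre ++ [a]) l
        rw [List.length_append, List.length_singleton, List.append_assoc, List.singleton_append,
          ← h, List.count_append] at this
        exact this
      have hc' : commas w pre.length = pre.count .comma := by
        rw [h]; exact commas_append_length pre (a :: l)
      split_ifs with ha
      · subst ha
        have e1 : commas w (pre.length + 1) = commas w pre.length + 1 := by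
          rw [hc, hc']; simp
        have e2 : offset w (pre.length + 1) = 0 := by
          rw [offset, List.length_eq_zero_iff, List.filter_eq_nil_iff]
          intro r hr
          have := commas_mono w (Nat.lt_succ_iff.1 (List.mem_range.1 hr))
          simp; omega
        rw [e1, e2]
      · have e1 : commas w (pre.length + 1) = commas w pre.length := by
          rw [hc, hc']; simp [ha]
        rw [e1]
        congr 1
        rw [offset, List.range_succ, List.filter_append, e1]
        simp [offset]
  have h0 := key w [] rfl
  simpa [commas, offset] using h0

/-- The word that consists of the given tokens, each of which is followed by a comma. -/
def join (toks : List (List Γ')) : List Γ' := toks.flatMap fun t => t ++ [Γ'.comma]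

theorem annotate_token {t : List Γ'} (ht : Γ'.comma ∉ t) (l : List Γ') (c p : ℕ) :
    annotate (t ++ l) c p
      = (t.zipIdx p).map (fun x => (x.1, c, x.2)) ++ annotate l c (p + t.length) := by
  induction t generalizing p with
  | nil => simp
  | cons a t ih =>
    simp only [List.mem_cons, not_or] at ht
    rw [List.cons_append, annotate, if_neg (Ne.symm ht.1), ih ht.2]
    simp [Nat.add_comm, Nat.add_left_comm]

/-- The sum of `F` over the symbols of a token, and the comma that follows it. -/
def tokenSum (F : Γ' → ℕ → ℕ → ℕ) (k : ℕ) (t : List Γ') : ℕ :=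
  (t.zipIdx.map fun x => F x.1 k x.2).sum

theorem sum_annotate_join (F : Γ' → ℕ → ℕ → ℕ) {toks : List (List Γ')}
    (h : ∀ t ∈ toks, Γ'.comma ∉ t) {tail : List Γ'} (htail : Γ'.comma ∉ tail) (c : ℕ) :
    ((annotate (join toks ++ tail) c 0).map fun x => F x.1 x.2.1 x.2.2).sum
      = ((toks.zipIdx c).map fun x => tokenSum F x.2 x.1 + F .comma x.2 x.1.length).sum
        + tokenSum F (c + toks.length) tail := by
  induction toks generalizing c with
  | nil =>
    have := annotate_token htail [] c 0
    rw [List.append_nil] at this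
    simp [join, this, annotate, tokenSum, Function.comp_def]
  | cons t toks ih =>
    have ht := h t (by simp)
    have hj : join (t :: toks) ++ tail = t ++ Γ'.comma :: (join toks ++ tail) := by simp [join]
    rw [hj, annotate_token ht, annotate, if_pos rfl, List.map_append, List.sum_append,
      List.map_cons, List.sum_cons, ih (fun t' h' => h t' (by simp [h']))]
    simp [tokenSum, Function.comp_def]
    ring_nf

theorem sum_zipIdx_eq_getElem (f : List Γ' → ℕ) (toks : List (List Γ')) (k c : ℕ) :
    ((toks.zipIdx c).map fun x => if x.2 = c + k then f x.1 else 0).sum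
      = (toks[k]?.map f).getD 0 := by
  induction toks generalizing k c with
  | nil => simp
  | cons t toks ih =>
    rcases k with _ | k
    · have : ((toks.zipIdx (c + 1)).map fun x => if x.2 = c + 0 then f x.1 else 0).sum = 0 := by
        refine List.sum_eq_zero fun y hy => ?_
        obtain ⟨⟨t', j⟩, hj, rfl⟩ := List.mem_map.1 hy
        have := (List.mem_zipIdx hj).1
        rw [if_neg]; simp only; omega
      simp only [List.zipIdx_cons, List.map_cons, List.sum_cons, this]
      simp
    · have := ih k (c + 1)
      rw [show c + 1 + k = c + (k + 1) by ring] at this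
      simp [this]

theorem exists_join (w : List Γ') : ∃ toks tail, (∀ t ∈ toks, Γ'.comma ∉ t) ∧ Γ'.comma ∉ tail ∧
    w = join toks ++ tail := by
  induction w with
  | nil => exact ⟨[], [], by simp, by simp, by simp [join]⟩
  | cons a w ih =>
    obtain ⟨toks, tail, h1, h2, h3⟩ := ih
    by_cases ha : a = .comma
    · exact ⟨[] :: toks, tail, by simpa using h1, h2, by simp [join, ha, h3]⟩
    · rcases toks with _ | ⟨t, toks⟩
      · exact ⟨[], a :: tail, by simp, by simp [h2, Ne.symm ha], by simp [join, h3]⟩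
      · refine ⟨(a :: t) :: toks, tail, fun t' ht' => ?_, h2, by simp [join, h3]⟩
        rcases List.mem_cons.1 ht' with rfl | ht'
        · have := h1 t (by simp)
          simp [this, Ne.symm ha]
        · exact h1 t' (by simp [ht'])

/-! ### The tokens of an instance -/

/-- The token of an integer. -/
def intToken (z : ℤ) : List Γ' := .bit (decide (z < 0)) :: (encodeNat z.natAbs).map Γ'.bit

theorem encodeInt_eq (z : ℤ) : encodeInt z = intToken z ++ [.comma] := by
  simp [encodeInt, intToken]

/-- The entries of a matrix, row by row. -/
def entries {n m : ℕ} (a : Fin n → Fin m → ℤ) : List ℤ :=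
  List.ofFn fun x : Fin (n * m) => a x.divNat x.modNat

theorem encodeMatrix_eq {n m : ℕ} (a : Fin n → Fin m → ℤ) :
    encodeMatrix a = join ((entries a).map intToken) := by
  have h : entries a = (List.finRange n).flatMap fun i => (List.finRange m).map (a i) := by
    rw [entries, List.ofFn_mul, List.flatMap, ← List.ofFn_eq_map]
    simp only [List.ofFn_eq_map]
    congr 1
    refine List.map_congr_left fun i _ => List.map_congr_left fun j _ => ?_
    congr 1
    · have : (i * m + j : ℕ) / m = i := by
        rw [Nat.add_comm, Nat.add_mul_div_right _ _ j.pos, Nat.div_eq_of_lt j.2, zero_add]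
      exact Fin.ext this
    · have : (i * m + j : ℕ) % m = j := by
        rw [Nat.add_comm, Nat.add_mul_mod_self_right, Nat.mod_eq_of_lt j.2]
      exact Fin.ext this
  rw [h, encodeMatrix, join, List.map_flatMap, List.flatMap_assoc]
  simp [List.flatMap_map, encodeInt_eq]

theorem length_entries {n m : ℕ} (a : Fin n → Fin m → ℤ) : (entries a).length = n * m := by
  simp [entries]

theorem getElem?_entries {n m : ℕ} (a : Fin n → Fin m → ℤ) (i : Fin n) (j : Fin m) :
    (entries a)[(m * i + j : ℕ)]? = some (a i j) := by
  have h : m * i + j < n * m := (Fin.mkDivMod i j).2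
  rw [List.getElem?_eq_getElem (by rw [length_entries]; exact h)]
  simp only [entries, List.getElem_ofFn]
  change some (a (Fin.mkDivMod i j).divNat (Fin.mkDivMod i j).modNat) = _
  simp

theorem exists_entries (n m : ℕ) {l : List ℤ} (hl : l.length = n * m) :
    ∃ a : Fin n → Fin m → ℤ, entries a = l := by
  refine ⟨fun i j => l[(Fin.mkDivMod i j : ℕ)]'(by rw [hl]; exact (Fin.mkDivMod i j).2), ?_⟩
  refine List.ext_getElem (by rw [length_entries, hl]) fun k h1 h2 => ?_
  simp [entries]

/-- The tokens of an instance. -/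
def Instance.tokens (I : Instance) : List (List Γ') :=
  List.replicate I.n .bra :: List.replicate I.m .bra ::
    ((entries I.u).map intToken ++ (entries I.v).map intToken)

theorem Instance.encode_eq (I : Instance) : I.encode = join I.tokens := by
  rw [Instance.encode, encodeMatrix_eq, encodeMatrix_eq]
  simp [join, Instance.tokens]

/-- The most significant digit comes last, so the absence of superfluous zeros means that the last
digit is `true`. -/
theorem exists_encodePosNum {l : List Bool} (h : l.getLast? = some true) :
    ∃ k : PosNum, encodePosNum k = l := by
  induction l with
  | nil => simp at h
  | cons b l ih =>
    rcases l with _ | ⟨b', l⟩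
    · simp at h; exact ⟨.one, by simp [encodePosNum, h]⟩
    · obtain ⟨k, hk⟩ := ih (by simpa using h)
      cases b
      · exact ⟨.bit0 k, by simp [encodePosNum, hk]⟩
      · exact ⟨.bit1 k, by simp [encodePosNum, hk]⟩

theorem exists_encodeNat {l : List Bool} (h : ∀ b ∈ l.getLast?, b = true) :
    ∃ k : ℕ, encodeNat k = l ∧ (k = 0 ↔ l = []) := by
  rcases hl : l.getLast? with _ | b
  · rw [List.getLast?_eq_none_iff] at hl
    exact ⟨0, by simp [hl, encodeNat, encodeNum]⟩
  · obtain rfl := h b (by simp [hl])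
    obtain ⟨k, hk⟩ := exists_encodePosNum hl
    refine ⟨k, ?_, ?_⟩
    · rw [← hk]
      change encodeNum ((k : ℕ) : Num) = _
      rw [PosNum.of_to_nat]
      rfl
    · have := PosNum.to_nat_pos k
      constructor
      · omega
      · rintro rfl; simp at hl

/-- The condition `hl` covers two requirements: digits, if any, end with `true`; and if there are
none, the lone sign bit is `false`, which excludes a negative zero. -/
theorem exists_intToken {t : List Γ'} (h : ∀ a ∈ t, ∃ b, a = Γ'.bit b) (h0 : t ≠ [])
    (hl : t.getLast? = some (.bit true) ↔ 1 < t.length) : ∃ z, t = intToken z := by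
  obtain ⟨bs, rfl⟩ : ∃ bs : List Bool, t = bs.map Γ'.bit := by
    clear h0 hl
    induction t with
    | nil => exact ⟨[], rfl⟩
    | cons a t ih =>
      obtain ⟨b, rfl⟩ := h a (by simp)
      obtain ⟨bs, rfl⟩ := ih fun a ha => h a (by simp [ha])
      exact ⟨b :: bs, rfl⟩
  rcases bs with _ | ⟨s, bs⟩
  · simp at h0
  have hlast : ∀ b ∈ bs.getLast?, b = true := by
    intro b hb
    have hbs : bs ≠ [] := by rintro rfl; simp at hb
    have h1 := hl.2 (by simpa [List.length_pos_iff] using hbs)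
    rw [List.map_cons, List.getLast?_cons, List.getLast?_map, hb] at h1
    simpa using h1
  obtain ⟨k, hk, hk0⟩ := exists_encodeNat hlast
  have hs : bs = [] → s = false := by
    rintro rfl
    simpa using hl
  refine ⟨if s then -k else k, ?_⟩
  cases s
  · simp [intToken, hk]
  · have : k ≠ 0 := fun h => by simpa using hs (hk0.1 h)
    simp [intToken, hk]
    omega

/-! ### Sums over the symbols of a word -/

/-- The sum of `F` over all symbols of a word, annotated with the number of their token and their
position in the token. -/
def wsum (w : List Γ') (F : Γ' → ℕ → ℕ → ℕ) : ℕ :=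
  ((annotate w 0 0).map fun x => F x.1 x.2.1 x.2.2).sum

theorem wsum_join {toks : List (List Γ')} (h : ∀ t ∈ toks, Γ'.comma ∉ t) {tail : List Γ'}
    (htail : Γ'.comma ∉ tail) (F : Γ' → ℕ → ℕ → ℕ) : wsum (join toks ++ tail) F =
      ((toks.zipIdx).map fun x => tokenSum F x.2 x.1 + F .comma x.2 x.1.length).sum
        + tokenSum F toks.length tail := by
  rw [wsum, sum_annotate_join F h htail, zero_add]

/-- The indicator of `k = c` selects one token, and `hG` discards the comma that ends it. -/
theorem wsum_token {toks : List (List Γ')} (h : ∀ t ∈ toks, Γ'.comma ∉ t) {tail : List Γ'}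
    (htail : Γ'.comma ∉ tail) (G : Γ' → ℕ → ℕ) (hG : ∀ p, G .comma p = 0) {c : ℕ} {t : List Γ'}
    (hc : toks[c]? = some t) :
    wsum (join toks ++ tail) (fun a k p => if k = c then G a p else 0)
      = (t.zipIdx.map fun x => G x.1 x.2).sum := by
  have hlt : c < toks.length := (List.getElem?_eq_some_iff.1 hc).1
  rw [wsum_join h htail]
  have e1 : tokenSum (fun a k p => if k = c then G a p else 0) toks.length tail = 0 := by
    simp [tokenSum, show toks.length ≠ c by omega]
  have e2 := sum_zipIdx_eq_getElem (fun t => (t.zipIdx.map fun x => G x.1 x.2).sum) toks c 0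
  rw [e1, add_zero]
  rw [hc] at e2
  refine Eq.trans ?_ e2
  congr 1
  refine List.map_congr_left fun x _ => ?_
  simp only [zero_add, tokenSum, hG]
  split_ifs <;> simp

/-- Sums of natural numbers vanish only termwise; thus a condition on all symbols can be stated as a
vanishing sum. -/
theorem wsum_eq_zero_iff {toks : List (List Γ')} (h : ∀ t ∈ toks, Γ'.comma ∉ t) {tail : List Γ'}
    (htail : Γ'.comma ∉ tail) (F : Γ' → ℕ → ℕ) :
    wsum (join toks ++ tail) (fun a k _ => F a k) = 0 ↔
      (∀ k t, toks[k]? = some t → (∀ a ∈ t, F a k = 0) ∧ F .comma k = 0) ∧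
      ∀ a ∈ tail, F a toks.length = 0 := by
  have e : ∀ k (t : List Γ'), tokenSum (fun a k _ => F a k) k t = 0 ↔ ∀ a ∈ t, F a k = 0 := by
    intro k t
    rw [tokenSum, List.sum_eq_zero_iff]
    constructor
    · intro h a ha
      obtain ⟨p, hp⟩ := List.mem_iff_getElem?.1 ha
      exact h _ (List.mem_map.2 ⟨(a, p), List.mem_zipIdx_iff_getElem?.2 hp, rfl⟩)
    · intro h y hy
      obtain ⟨x, hx, rfl⟩ := List.mem_map.1 hy
      exact h _ (List.fst_mem_of_mem_zipIdx hx)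
  rw [wsum_join h htail, Nat.add_eq_zero_iff, e]
  refine and_congr_left fun _ => ?_
  simp only [List.sum_eq_zero_iff, List.mem_map, Prod.exists, forall_exists_index, and_imp,
    List.mem_zipIdx_iff_getElem?]
  constructor
  · intro h k t hk
    have := h _ t k hk rfl
    rwa [Nat.add_eq_zero_iff, e] at this
  · rintro h _ t k hk rfl
    rw [Nat.add_eq_zero_iff, e]
    exact h k t hk

theorem wsum_comma {toks : List (List Γ')} (h : ∀ t ∈ toks, Γ'.comma ∉ t) {tail : List Γ'}
    (htail : Γ'.comma ∉ tail) :
    wsum (join toks ++ tail) (fun a _ _ => if a = .comma then 1 else 0) = toks.length := by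
  have e : ∀ k (t : List Γ'), Γ'.comma ∉ t →
      tokenSum (fun a _ _ => if a = .comma then 1 else 0) k t = 0 := by
    intro k t ht
    refine List.sum_eq_zero fun x hx => ?_
    obtain ⟨y, hy, rfl⟩ := List.mem_map.1 hx
    refine if_neg fun h => ?_
    exact ht (h ▸ List.fst_mem_of_mem_zipIdx hy)
  rw [wsum_join h htail, e _ _ htail, add_zero]
  rw [List.map_congr_left (g := fun _ => 1)]
  · simp
  · rintro ⟨t, k⟩ hx
    rw [e _ _ (h t (List.fst_mem_of_mem_zipIdx hx))]
    simp

end QV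

namespace QV

open Computability

/-! ### Decoding instances -/

/-- The number of symbols `bra` in token `c`. -/
def numBra (w : List Γ') (c : ℕ) : ℕ :=
  wsum w fun a k _ => if k = c then if a = .bra then 1 else 0 else 0

/-- The number of tokens that are followed by a comma. -/
def numTokens (w : List Γ') : ℕ := wsum w fun a _ _ => if a = .comma then 1 else 0

/-- The length of token `c`. -/
def tokLen (w : List Γ') (c : ℕ) : ℕ :=
  wsum w fun a k _ => if k = c then if a = .comma then 0 else 1 else 0

/-- The sign bit of token `c`. -/
def tokSign (w : List Γ') (c : ℕ) : ℕ :=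
  wsum w fun a k p => if k = c then if a = .bit true ∧ p = 0 then 1 else 0 else 0

/-- The absolute value of the integer that is encoded by token `c`. -/
def tokAbs (w : List Γ') (c : ℕ) : ℕ :=
  wsum w fun a k p => if k = c then if a = .bit true ∧ 0 < p then 2 ^ (p - 1) else 0 else 0

/-- The last bit of token `c`. -/
def tokLast (w : List Γ') (c : ℕ) : ℕ :=
  wsum w fun a k p => if k = c then if a = .bit true ∧ p + 1 = tokLen w c then 1 else 0 else 0

/-- The integer that is encoded by token `c`. -/
def tokInt (w : List Γ') (c : ℕ) : ℤ := if 0 < tokSign w c then -tokAbs w c else tokAbs w c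

section

variable {toks : List (List Γ')} {tail : List Γ'} {c : ℕ} {t : List Γ'}

theorem sum_bra (t : List Γ') (s : ℕ) :
    ((t.zipIdx s).map fun x => if x.1 = Γ'.bra then 1 else 0).sum = t.count .bra := by
  induction t generalizing s with
  | nil => simp
  | cons a t ih =>
    rw [List.zipIdx_cons, List.map_cons, List.sum_cons, ih, List.count_cons, add_comm]
    simp

theorem numBra_join (h : ∀ t ∈ toks, Γ'.comma ∉ t) (htail : Γ'.comma ∉ tail)
    (hc : toks[c]? = some t) : numBra (join toks ++ tail) c = t.count .bra := by
  rw [numBra, wsum_token h htail _ (by simp) hc, sum_bra]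

theorem tokLen_join (h : ∀ t ∈ toks, Γ'.comma ∉ t) (htail : Γ'.comma ∉ tail)
    (hc : toks[c]? = some t) : tokLen (join toks ++ tail) c = t.length := by
  rw [tokLen, wsum_token h htail _ (by simp) hc, List.map_congr_left (g := fun _ => 1)]
  · simp
  · intro x hx
    refine if_neg fun h' => ?_
    exact h t (List.mem_of_getElem? hc) (h' ▸ List.fst_mem_of_mem_zipIdx hx)

theorem sum_last (t : List Γ') : (t.zipIdx.map fun x =>
    if x.1 = Γ'.bit true ∧ x.2 + 1 = t.length then 1 else 0).sum
      = if t.getLast? = some (.bit true) then 1 else 0 := by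
  rcases List.eq_nil_or_concat t with rfl | ⟨t, a, rfl⟩
  · simp
  · rw [List.concat_eq_append, List.zipIdx_append, List.map_append, List.sum_append,
      List.sum_eq_zero]
    · simp
    · intro y hy
      obtain ⟨x, hx, rfl⟩ := List.mem_map.1 hy
      have := List.snd_lt_of_mem_zipIdx hx
      refine if_neg ?_
      simp; omega

theorem tokLast_join (h : ∀ t ∈ toks, Γ'.comma ∉ t) (htail : Γ'.comma ∉ tail)
    (hc : toks[c]? = some t) :
    tokLast (join toks ++ tail) c = if t.getLast? = some (.bit true) then 1 else 0 := by
  rw [tokLast, wsum_token h htail _ (by simp) hc, tokLen_join h htail hc, sum_last]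

theorem tokSign_join (h : ∀ t ∈ toks, Γ'.comma ∉ t) (htail : Γ'.comma ∉ tail) {z : ℤ}
    (hc : toks[c]? = some (intToken z)) : 0 < tokSign (join toks ++ tail) c ↔ z < 0 := by
  rw [tokSign, wsum_token h htail _ (by simp) hc, intToken, List.zipIdx_cons, List.map_cons,
    List.sum_cons, List.sum_eq_zero (l := List.map _ (List.zipIdx _ _))]
  · by_cases hz : z < 0 <;> simp [hz]
  · intro y hy
    obtain ⟨x, hx, rfl⟩ := List.mem_map.1 hy
    have := List.le_snd_of_mem_zipIdx hx
    refine if_neg ?_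
    simp; omega

theorem sum_bits (l : List Bool) (s : ℕ) : (((l.map Γ'.bit).zipIdx (s + 1)).map fun x =>
    if x.1 = Γ'.bit true ∧ 0 < x.2 then 2 ^ (x.2 - 1) else 0).sum
      = 2 ^ s * l.foldr (fun b k => b.toNat + 2 * k) 0 := by
  induction l generalizing s with
  | nil => simp
  | cons b l ih =>
    rw [List.map_cons, List.zipIdx_cons, List.map_cons, List.sum_cons, ih, List.foldr_cons]
    cases b <;> simp [pow_succ] <;> ring

theorem foldr_encodePosNum (k : PosNum) :
    (encodePosNum k).foldr (fun b k => b.toNat + 2 * k) 0 = (k : ℕ) := by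
  induction k with
  | one => rfl
  | bit0 k ih => rw [encodePosNum, List.foldr_cons, ih, PosNum.cast_bit0]; simp [two_mul]
  | bit1 k ih =>
    rw [encodePosNum, List.foldr_cons, ih, PosNum.cast_bit1]; simp [two_mul, add_comm]

theorem getLast?_encodePosNum (k : PosNum) : (encodePosNum k).getLast? = some true := by
  induction k with
  | one => rfl
  | bit0 k ih => rw [encodePosNum, List.getLast?_cons, ih]; rfl
  | bit1 k ih => rw [encodePosNum, List.getLast?_cons, ih]; rfl

theorem foldr_encodeNat (k : ℕ) : (encodeNat k).foldr (fun b k => b.toNat + 2 * k) 0 = k := by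
  conv_rhs => rw [← Num.to_of_nat k]
  rw [encodeNat]
  rcases (k : Num) with _ | p
  · rfl
  · exact foldr_encodePosNum p

theorem tokAbs_join (h : ∀ t ∈ toks, Γ'.comma ∉ t) (htail : Γ'.comma ∉ tail) {z : ℤ}
    (hc : toks[c]? = some (intToken z)) : tokAbs (join toks ++ tail) c = z.natAbs := by
  rw [tokAbs, wsum_token h htail _ (by simp) hc, intToken, List.zipIdx_cons, List.map_cons,
    List.sum_cons, sum_bits, foldr_encodeNat]
  simp

theorem tokInt_join (h : ∀ t ∈ toks, Γ'.comma ∉ t) (htail : Γ'.comma ∉ tail) {z : ℤ}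
    (hc : toks[c]? = some (intToken z)) : tokInt (join toks ++ tail) c = z := by
  rw [tokInt, tokAbs_join h htail hc]
  simp only [tokSign_join h htail hc]
  split_ifs <;> omega

end

/-! ### Recognition of encodings -/

/-- The word is the encoding of an instance. -/
def Valid (w : List Γ') : Prop :=
  numTokens w = 2 + 2 * (numBra w 0 * numBra w 1) ∧
  -- Nothing follows the last comma.
  wsum w (fun _ k _ => if k < numTokens w then 0 else 1) = 0 ∧
  wsum w (fun a k _ => if a ∈ [Γ'.bra, .comma] ∨ 2 ≤ k then 0 else 1) = 0 ∧
  wsum w (fun a k _ => if a ∈ [Γ'.bit false, .bit true, .comma] ∨ k < 2 then 0 else 1) = 0 ∧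
  -- Restricting `k` to positions makes this expressible; nothing is lost, since every token counted
  -- by `numTokens` contributes a comma.
  ∀ k < w.length, 2 ≤ k → k < numTokens w →
    0 < tokLen w k ∧ (0 < tokLast w k ↔ 1 < tokLen w k)

theorem comma_notMem_intToken (z : ℤ) : Γ'.comma ∉ intToken z := by simp [intToken]

theorem Instance.comma_notMem (I : Instance) : ∀ t ∈ I.tokens, Γ'.comma ∉ t := by
  intro t ht
  simp only [Instance.tokens, List.mem_cons, List.mem_append, List.mem_map] at ht
  rcases ht with rfl | rfl | ⟨z, -, rfl⟩ | ⟨z, -, rfl⟩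
  · simp [List.mem_replicate]
  · simp [List.mem_replicate]
  · exact comma_notMem_intToken z
  · exact comma_notMem_intToken z

theorem Instance.encode_eq' (I : Instance) : I.encode = join I.tokens ++ [] := by
  rw [I.encode_eq, List.append_nil]

theorem Instance.length_tokens (I : Instance) : I.tokens.length = 2 + 2 * (I.n * I.m) := by
  simp [Instance.tokens, length_entries]; ring

theorem Instance.numBra_zero (I : Instance) : numBra I.encode 0 = I.n := by
  rw [I.encode_eq', numBra_join I.comma_notMem (by simp) (t := List.replicate I.n .bra) rfl]
  simp

theorem Instance.numBra_one (I : Instance) : numBra I.encode 1 = I.m := by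
  rw [I.encode_eq', numBra_join I.comma_notMem (by simp) (t := List.replicate I.m .bra) rfl]
  simp

theorem Instance.numTokens_encode (I : Instance) : numTokens I.encode = 2 + 2 * (I.n * I.m) := by
  rw [I.encode_eq', numTokens, wsum_comma I.comma_notMem (by simp), I.length_tokens]

theorem Instance.getElem?_tokens (I : Instance) (k : ℕ) : I.tokens[2 + k]?
    = ((entries I.u ++ entries I.v).map intToken)[k]? := by
  rw [Instance.tokens, ← List.map_append, add_comm]
  rfl

theorem Instance.tokInt_u (I : Instance) (i : Fin I.n) (j : Fin I.m) :
    tokInt I.encode (2 + (I.m * i + j)) = I.u i j := by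
  rw [I.encode_eq']
  refine tokInt_join I.comma_notMem (by simp) ?_
  have := getElem?_entries I.u i j
  rw [I.getElem?_tokens, List.getElem?_map, List.getElem?_append_left, this]
  · rfl
  · exact (List.getElem?_eq_some_iff.1 this).1

theorem Instance.tokInt_v (I : Instance) (i : Fin I.n) (j : Fin I.m) :
    tokInt I.encode (2 + (I.n * I.m + (I.m * i + j))) = I.v i j := by
  rw [I.encode_eq']
  refine tokInt_join I.comma_notMem (by simp) ?_
  rw [I.getElem?_tokens, List.getElem?_map, List.getElem?_append_right (by
    rw [length_entries]; omega), length_entries, Nat.add_sub_cancel_left, getElem?_entries]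
  rfl

theorem length_join_ge {toks : List (List Γ')} {s : ℕ} (h : ∀ t ∈ toks, s ≤ t.length) :
    toks.length * (s + 1) ≤ (join toks).length := by
  induction toks with
  | nil => simp
  | cons t toks ih =>
    have h1 := ih fun t' ht' => h t' (by simp [ht'])
    have h2 := h t (by simp)
    simp only [join, List.flatMap_cons, List.length_append, List.length_cons,
      List.length_nil] at h1 ⊢
    rw [add_mul]
    omega

/-- Each of the `2 * (n * m)` integers takes at least a sign bit and a comma. The bound ensures that
the ranges of the quantifiers fit into the word. -/
theorem Instance.length_encode_ge (I : Instance) :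
    I.n + I.m + 2 + 4 * (I.n * I.m) ≤ I.encode.length := by
  have h1 := length_join_ge (s := 1) (toks := (entries I.u ++ entries I.v).map intToken) (by
    intro t ht
    obtain ⟨z, -, rfl⟩ := List.mem_map.1 ht
    simp [intToken])
  rw [List.length_map, List.length_append, length_entries, length_entries] at h1
  rw [I.encode_eq, Instance.tokens, ← List.map_append]
  simp only [join, List.flatMap_cons, List.length_append, List.length_replicate,
    List.length_cons, List.length_nil] at h1 ⊢
  omega

theorem getLast?_intToken (z : ℤ) :
    (intToken z).getLast? = some (.bit true) ↔ 1 < (intToken z).length := by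
  have h : encodeNat z.natAbs = [] ∧ z.natAbs = 0 ∨
      (encodeNat z.natAbs).getLast? = some true := by
    have h0 := Num.to_of_nat z.natAbs
    rw [encodeNat]
    generalize (z.natAbs : Num) = k at h0 ⊢
    rcases k with _ | p
    · exact .inl ⟨rfl, h0.symm⟩
    · exact .inr (getLast?_encodePosNum p)
  rcases h with ⟨h, hz⟩ | h
  · obtain rfl := Int.natAbs_eq_zero.1 hz
    simp [intToken, encodeNat, encodeNum]
  · have : encodeNat z.natAbs ≠ [] := by rintro h'; simp [h'] at h
    rw [intToken, List.getLast?_cons, List.getLast?_map, h]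
    simpa [List.length_pos_iff] using this

theorem Instance.valid (I : Instance) : Valid I.encode := by
  refine ⟨by rw [I.numTokens_encode, I.numBra_zero, I.numBra_one], ?_, ?_, ?_, ?_⟩
  · rw [I.numTokens_encode, I.encode_eq', wsum_eq_zero_iff I.comma_notMem (by simp)
      (fun _ k => if k < 2 + 2 * (I.n * I.m) then 0 else 1)]
    refine ⟨fun k t hk => ?_, by simp⟩
    have := (List.getElem?_eq_some_iff.1 hk).1
    rw [I.length_tokens] at this
    simp [this]
  · rw [I.encode_eq', wsum_eq_zero_iff I.comma_notMem (by simp)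
      (fun a k => if a ∈ [Γ'.bra, .comma] ∨ 2 ≤ k then 0 else 1)]
    refine ⟨fun k t hk => ⟨fun a ha => ?_, by simp⟩, by simp⟩
    rcases k with _ | _ | k
    · obtain rfl : List.replicate I.n Γ'.bra = t := by simpa [Instance.tokens] using hk
      simp [(List.mem_replicate.1 ha).2]
    · obtain rfl : List.replicate I.m Γ'.bra = t := by simpa [Instance.tokens] using hk
      simp [(List.mem_replicate.1 ha).2]
    · simp
  · rw [I.encode_eq', wsum_eq_zero_iff I.comma_notMem (by simp)
      (fun a k => if a ∈ [Γ'.bit false, .bit true, .comma] ∨ k < 2 then 0 else 1)]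
    refine ⟨fun k t hk => ⟨fun a ha => ?_, by simp⟩, by simp⟩
    rcases k with _ | _ | k
    · simp
    · simp
    · rw [show k + 1 + 1 = 2 + k by ring, I.getElem?_tokens, List.getElem?_map,
        Option.map_eq_some_iff] at hk
      obtain ⟨z, -, rfl⟩ := hk
      simp only [intToken, List.mem_cons, List.mem_map] at ha
      rcases ha with rfl | ⟨b, -, rfl⟩
      · cases decide (z < 0) <;> simp
      · cases b <;> simp
  · intro k _ h2 hk
    obtain ⟨k, rfl⟩ := Nat.exists_eq_add_of_le h2
    rw [I.numTokens_encode, ← I.length_tokens] at hk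
    have h3 := List.getElem?_eq_getElem hk
    have h4 := h3
    rw [I.getElem?_tokens, List.getElem?_map, Option.map_eq_some_iff] at h4
    obtain ⟨z, -, hz⟩ := h4
    rw [← hz] at h3
    rw [I.encode_eq', tokLen_join I.comma_notMem (by simp) h3,
      tokLast_join I.comma_notMem (by simp) h3, ← getLast?_intToken]
    refine ⟨by simp [intToken], ?_⟩
    split_ifs with h <;> simp [h]

theorem eq_replicate_of_forall {t : List Γ'} (h : ∀ a ∈ t, a = Γ'.bra) :
    t = List.replicate (t.count .bra) .bra := by
  rw [List.count_eq_length.2 fun a ha => (h a ha).symm]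
  exact List.eq_replicate_of_mem h

/-- The first two tokens determine `n` and `m`; the count of tokens leaves `2 * (n * m)` integers,
whose halves are the entries of `u` and `v`. -/
theorem Valid.exists_instance {w : List Γ'} (h : Valid w) : ∃ I : Instance, I.encode = w := by
  obtain ⟨toks, tail, hc, ht, rfl⟩ := exists_join w
  obtain ⟨h1, h2, h3, h4, h5⟩ := h
  have hC : numTokens (join toks ++ tail) = toks.length := wsum_comma hc ht
  rw [hC] at h1 h2 h5
  rw [wsum_eq_zero_iff hc ht (fun _ k => if k < toks.length then 0 else 1)] at h2
  rw [wsum_eq_zero_iff hc ht (fun a k => if a ∈ [Γ'.bra, .comma] ∨ 2 ≤ k then 0 else 1)] at h3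
  rw [wsum_eq_zero_iff hc ht
    (fun a k => if a ∈ [Γ'.bit false, .bit true, .comma] ∨ k < 2 then 0 else 1)] at h4
  obtain rfl : tail = [] := by
    rcases tail with _ | ⟨a, tail⟩
    · rfl
    · simpa using h2.2 a (by simp)
  obtain ⟨t₀, t₁, ts, rfl⟩ : ∃ t₀ t₁ ts, toks = t₀ :: t₁ :: ts := by
    rcases toks with _ | ⟨t₀, _ | ⟨t₁, ts⟩⟩
    · simp at h1; omega
    · simp at h1; omega
    · exact ⟨t₀, t₁, ts, rfl⟩
  have e0 : t₀ = List.replicate (t₀.count .bra) .bra := eq_replicate_of_forall fun a ha => by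
    have := (h3.1 0 t₀ rfl).1 a ha
    have hne : a ≠ .comma := fun h => hc t₀ (by simp) (h ▸ ha)
    simpa [hne] using this
  have e1 : t₁ = List.replicate (t₁.count .bra) .bra := eq_replicate_of_forall fun a ha => by
    have := (h3.1 1 t₁ rfl).1 a ha
    have hne : a ≠ .comma := fun h => hc t₁ (by simp) (h ▸ ha)
    simpa [hne] using this
  rw [numBra_join hc ht (t := t₀) rfl, numBra_join hc ht (t := t₁) rfl] at h1
  set n := t₀.count .bra
  set m := t₁.count .bra
  have hts : ∀ t ∈ ts, ∃ z, intToken z = t := by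
    intro t hmem
    obtain ⟨k, hk⟩ := List.mem_iff_getElem?.1 hmem
    have hk' : (t₀ :: t₁ :: ts)[2 + k]? = some t := by rw [add_comm]; exact hk
    have hlt := (List.getElem?_eq_some_iff.1 hk').1
    have hlen : (t₀ :: t₁ :: ts).length ≤ (join (t₀ :: t₁ :: ts) ++ []).length := by
      have := length_join_ge (toks := t₀ :: t₁ :: ts) (s := 0) (by simp)
      simpa using this
    have h6 := h5 (2 + k) (by omega) (by omega) hlt
    rw [tokLen_join hc ht hk', tokLast_join hc ht hk'] at h6
    obtain ⟨z, hz⟩ := exists_intToken (t := t) (fun a ha => by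
      have := (h4.1 _ t hk').1 a ha
      have hne : a ≠ .comma := fun h => hc t (by simp [hmem]) (h ▸ ha)
      have h7 : a = .bit false ∨ a = .bit true := by
        by_contra h7
        push Not at h7
        rw [if_neg (by simp [h7, hne]; omega)] at this
        exact one_ne_zero this
      rcases h7 with rfl | rfl
      · exact ⟨_, rfl⟩
      · exact ⟨_, rfl⟩) (List.length_pos_iff.1 h6.1) (by
        rw [← h6.2]; split_ifs with h <;> simp [h])
    exact ⟨z, hz.symm⟩
  obtain ⟨zs, rfl⟩ : ∃ zs : List ℤ, zs.map intToken = ts := by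
    have : ts ∈ Set.range (List.map intToken) := by
      rw [Set.range_list_map]
      exact hts
    exact this
  have hlen : zs.length = 2 * (n * m) := by
    simp only [List.length_cons, List.length_map] at h1; omega
  obtain ⟨u, hu⟩ := exists_entries n m (l := zs.take (n * m)) (by simp; omega)
  obtain ⟨v, hv⟩ := exists_entries n m (l := zs.drop (n * m)) (by simp; omega)
  refine ⟨⟨n, m, u, v⟩, ?_⟩
  rw [Instance.encode_eq']
  congr 2
  rw [Instance.tokens, ← List.map_append]
  simp only [hu, hv, List.take_append_drop]
  rw [← e0, ← e1]

theorem valid_iff {w : List Γ'} : Valid w ↔ ∃ I : Instance, I.encode = w :=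
  ⟨Valid.exists_instance, by rintro ⟨I, rfl⟩; exact I.valid⟩

end QV

/-! ## Formulas -/

namespace StackProg

open Function Computability

variable {w : List Γ'} {ρ : ℕ → ℕ}

theorem foldl_sumStep_false (s : Γ' → Bool) (g : ℕ → ℕ) (l : List (Γ' × ℕ)) (a : ℕ) :
    l.foldl (sumStep s false g) a = a + (l.map fun x => if s x.1 then g x.2 else 0).sum := by
  induction l generalizing a with
  | nil => simp
  | cons x l ih =>
    rw [List.foldl_cons, ih, List.map_cons, List.sum_cons, sumStep]
    split_ifs <;> simp_all [add_assoc]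

/-- The `1` added at position `a` is doubled at each of the `w.length - 1 - a` later positions. -/
theorem foldl_sumStep_true (a : ℕ) (w : List Γ') :
    w.zipIdx.foldl (sumStep (fun _ => true) true fun j => if j = a then 1 else 0) 0
      = if a < w.length then 2 ^ (w.length - 1 - a) else 0 := by
  induction w using List.reverseRecOn with
  | nil => simp
  | append_singleton w b ih =>
    rw [List.zipIdx_append, List.foldl_append, ih]
    simp only [sumStep, List.zipIdx_cons, List.zipIdx_nil, List.foldl_cons, List.foldl_nil,
      if_true, List.length_append, List.length_singleton, zero_add]
    rcases lt_trichotomy a w.length with h | rfl | h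
    · rw [if_pos h, if_neg (by omega), if_pos (by omega), add_zero, ← pow_succ']
      congr 1; omega
    · simp
    · rw [if_neg (by omega), if_neg (by omega), if_neg (by omega)]

namespace Expr

/-- The formula `c` is true. -/
def Holds (w : List Γ') (ρ : ℕ → ℕ) (c : Expr) : Prop := c.eval w ρ ≠ 0

instance (w : List Γ') (ρ : ℕ → ℕ) (c : Expr) : Decidable (c.Holds w ρ) :=
  inferInstanceAs (Decidable (_ ≠ _))

/-- A natural number as an expression. -/
def num : ℕ → Expr
  | 0 => bit false
  | k + 1 => add (num k) (bit true)

@[simp] theorem eval_num (k : ℕ) : (num k).eval w ρ = k := by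
  induction k with
  | zero => rfl
  | succ k ih => simp [num, eval, ih]

@[simp] theorem eval_var (x : ℕ) : (var x).eval w ρ = ρ x := rfl

@[simp] theorem eval_add (a b : Expr) : (add a b).eval w ρ = a.eval w ρ + b.eval w ρ := rfl

@[simp] theorem eval_mul (a b : Expr) : (mul a b).eval w ρ = a.eval w ρ * b.eval w ρ := rfl

@[simp] theorem eval_sub (x : ℕ) (a b : Expr) :
    (sub x a b).eval w ρ = b.eval w (update ρ x (a.eval w ρ)) := rfl

@[simp] theorem holds_lt (a b : Expr) : (lt a b).Holds w ρ ↔ a.eval w ρ < b.eval w ρ := by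
  simp [Holds, eval]

/-- Negation. -/
def not (c : Expr) : Expr := lt c (num 1)

@[simp] theorem holds_not (c : Expr) : c.not.Holds w ρ ↔ ¬ c.Holds w ρ := by
  simp [not, Holds, eval]

/-- Conjunction. -/
def and (c d : Expr) : Expr := mul c d

@[simp] theorem holds_and (c d : Expr) : (c.and d).Holds w ρ ↔ c.Holds w ρ ∧ d.Holds w ρ := by
  simp [and, Holds]

/-- Implication. -/
def imp (c d : Expr) : Expr := (c.and d.not).not

@[simp] theorem holds_imp (c d : Expr) : (c.imp d).Holds w ρ ↔ (c.Holds w ρ → d.Holds w ρ) := by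
  simp [imp]

/-- Comparison. -/
def le (a b : Expr) : Expr := (lt b a).not

@[simp] theorem holds_le (a b : Expr) : (le a b).Holds w ρ ↔ a.eval w ρ ≤ b.eval w ρ := by
  simp [le]

/-- Equality. -/
def eq (a b : Expr) : Expr := (le a b).and (le b a)

@[simp] theorem holds_eq (a b : Expr) : (eq a b).Holds w ρ ↔ a.eval w ρ = b.eval w ρ := by
  simp [eq, le_antisymm_iff]

/-- The number that is equal to `a` if `c` is true, and to `b` otherwise. -/
def cond (c a b : Expr) : Expr := add (mul (lt (num 0) c) a) (mul c.not b)

@[simp] theorem eval_cond (c a b : Expr) :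
    (cond c a b).eval w ρ = if c.Holds w ρ then a.eval w ρ else b.eval w ρ := by
  by_cases h : c.eval w ρ = 0
  · simp [cond, Holds, not, eval, h]
  · have : 0 < c.eval w ρ := by omega
    have : ¬ c.eval w ρ < 1 := by omega
    simp [cond, Holds, not, eval, *]

theorem eval_sum_false (s : Γ' → Bool) (x : ℕ) (e : Expr) : (sum s false x e).eval w ρ
    = (w.zipIdx.map fun y => if s y.1 then e.eval w (update ρ x y.2) else 0).sum := by
  rw [eval, foldl_sumStep_false, zero_add]

/-- The sum over all positions. -/
def total (x : ℕ) (e : Expr) : Expr := sum (fun _ => true) false x e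

@[simp] theorem eval_total (x : ℕ) (e : Expr) :
    (total x e).eval w ρ = ∑ j ∈ Finset.range w.length, e.eval w (update ρ x j) := by
  rw [total, eval_sum_false, List.zipIdx_eq_zip_range']
  simp only [if_true]
  have : (w.zip (List.range' 0 w.length)).map (fun y => e.eval w (update ρ x y.2))
      = (List.range w.length).map fun j => e.eval w (update ρ x j) := by
    rw [← Function.comp_def (fun j => e.eval w (update ρ x j)) Prod.snd, ← List.map_map,
      List.map_snd_zip (by simp), List.range_eq_range']
  rw [this, Finset.sum, Finset.range_val, Multiset.range, Multiset.map_coe, Multiset.sum_coe]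

/-- The sum over all positions less than `b`. -/
def bsum (x : ℕ) (b e : Expr) : Expr := total x (cond (lt (var x) b) e (num 0))

/-- Quantification over all positions. -/
def all (x : ℕ) (c : Expr) : Expr := (total x c.not).not

@[simp] theorem holds_all (x : ℕ) (c : Expr) :
    (all x c).Holds w ρ ↔ ∀ j < w.length, c.Holds w (update ρ x j) := by
  rw [all, holds_not, Holds, eval_total]
  simp only [ne_eq, Finset.sum_eq_zero_iff, Finset.mem_range, not_not]
  refine forall₂_congr fun j _ => ?_
  have := holds_not (w := w) (ρ := update ρ x j) c
  rw [Holds] at this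
  tauto

/-- The length of the word. -/
def len : Expr := total 0 (num 1)

@[simp] theorem eval_len : len.eval w ρ = w.length := by simp [len]

/-- The power `2 ^ (a - 1)`, if `0 < a`. -/
def pow (x : ℕ) (a : Expr) : Expr :=
  sum (fun _ => true) true x (cond (eq (add (var x) a) len) (num 1) (num 0))

/-- The `1` is placed at position `w.length - k`, which is followed by `k - 1` doublings. This needs
`k ≤ w.length`, and a value of `a` that is independent of the summation variable. -/
theorem eval_pow {x : ℕ} {a : Expr} {k : ℕ} (ha : ∀ j, a.eval w (update ρ x j) = k)
    (h0 : 0 < k) (hk : k ≤ w.length) : (pow x a).eval w ρ = 2 ^ (k - 1) := by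
  have h : (fun j => (cond (eq (add (var x) a) len) (num 1) (num 0)).eval w (update ρ x j))
      = fun j => if j = w.length - k then 1 else 0 := by
    funext j
    simp only [eval_cond, holds_eq, eval_add, eval_var, update_self, ha, eval_len, eval_num]
    congr 1
    exact propext (by omega)
  rw [pow, eval, h, foldl_sumStep_true, if_pos (by omega)]
  congr 1; omega

end Expr

/-! ### Integers -/

/-- Pairs of expressions, which represent differences. -/
structure ZExpr where
  pos : Expr
  neg : Expr

namespace ZExpr

/-- The value of a difference. -/
def eval (w : List Γ') (ρ : ℕ → ℕ) (e : ZExpr) : ℤ := e.pos.eval w ρ - e.neg.eval w ρ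

/-- A natural number as an integer. -/
def ofNat (e : Expr) : ZExpr := ⟨e, .num 0⟩

@[simp] theorem eval_ofNat (e : Expr) : (ofNat e).eval w ρ = e.eval w ρ := by simp [ofNat, eval]

/-- The sum of two integers. -/
def add (a b : ZExpr) : ZExpr := ⟨.add a.pos b.pos, .add a.neg b.neg⟩

@[simp] theorem eval_add (a b : ZExpr) : (add a b).eval w ρ = a.eval w ρ + b.eval w ρ := by
  simp [add, eval]; ring

/-- The difference of two integers. -/
def sub (a b : ZExpr) : ZExpr := ⟨.add a.pos b.neg, .add a.neg b.pos⟩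

@[simp] theorem eval_sub (a b : ZExpr) : (sub a b).eval w ρ = a.eval w ρ - b.eval w ρ := by
  simp [sub, eval]; ring

/-- The product of two integers. -/
def mul (a b : ZExpr) : ZExpr :=
  ⟨.add (.mul a.pos b.pos) (.mul a.neg b.neg), .add (.mul a.pos b.neg) (.mul a.neg b.pos)⟩

@[simp] theorem eval_mul (a b : ZExpr) : (mul a b).eval w ρ = a.eval w ρ * b.eval w ρ := by
  simp [mul, eval]; ring

/-- Comparison. -/
def le (a b : ZExpr) : Expr := .le (.add a.pos b.neg) (.add b.pos a.neg)

@[simp] theorem holds_le (a b : ZExpr) : (le a b).Holds w ρ ↔ a.eval w ρ ≤ b.eval w ρ := by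
  simp only [le, Expr.holds_le, Expr.eval_add, eval]; omega

/-- The number that is equal to `a` if `c` is true, and to `b` otherwise. -/
def cond (c : Expr) (a b : ZExpr) : ZExpr := ⟨.cond c a.pos b.pos, .cond c a.neg b.neg⟩

@[simp] theorem eval_cond (c : Expr) (a b : ZExpr) :
    (cond c a b).eval w ρ = if c.Holds w ρ then a.eval w ρ else b.eval w ρ := by
  simp only [cond, eval, Expr.eval_cond]; split_ifs <;> rfl

/-- Substitution. -/
def subst (x : ℕ) (a : Expr) (e : ZExpr) : ZExpr := ⟨.sub x a e.pos, .sub x a e.neg⟩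

@[simp] theorem eval_subst (x : ℕ) (a : Expr) (e : ZExpr) :
    (subst x a e).eval w ρ = e.eval w (update ρ x (a.eval w ρ)) := rfl

/-- The sum over all positions less than `b`. -/
def bsum (x : ℕ) (b : Expr) (e : ZExpr) : ZExpr := ⟨.bsum x b e.pos, .bsum x b e.neg⟩

theorem eval_bsum {x : ℕ} {b : Expr} {e : ZExpr} {k : ℕ} (hb : ∀ j, b.eval w (update ρ x j) = k)
    (hk : k ≤ w.length) {f : Fin k → ℤ} (hf : ∀ j : Fin k, e.eval w (update ρ x j) = f j) :
    (bsum x b e).eval w ρ = ∑ j, f j := by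
  have h : ∀ e : Expr, (Expr.bsum x b e).eval w ρ = ∑ j : Fin k, e.eval w (update ρ x j) := by
    intro e
    simp only [Expr.bsum, Expr.eval_total, Expr.eval_cond, Expr.holds_lt, Expr.eval_var,
      update_self, hb, Expr.eval_num]
    rw [← Finset.sum_filter, ← Finset.sum_range fun j => e.eval w (update ρ x j)]
    refine Finset.sum_congr ?_ fun _ _ => rfl
    ext j; simp; omega
  simp only [bsum, eval, h, Nat.cast_sum, ← Finset.sum_sub_distrib]
  exact Finset.sum_congr rfl fun j _ => hf j

end ZExpr

/-- Quantification over all numbers less than `b`. -/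
def Expr.ball (x : ℕ) (b c : Expr) : Expr := .all x (.imp (.lt (.var x) b) c)

theorem Expr.holds_ball {x : ℕ} {b c : Expr} {k : ℕ} (hb : ∀ j, b.eval w (update ρ x j) = k)
    (hk : k ≤ w.length) {P : Fin k → Prop} (hP : ∀ j : Fin k, c.Holds w (update ρ x j) ↔ P j) :
    (ball x b c).Holds w ρ ↔ ∀ j, P j := by
  simp only [ball, holds_all, holds_imp, holds_lt, eval_var, update_self, hb]
  constructor
  · exact fun h j => (hP j).1 (h j (j.2.trans_le hk) j.2)
  · exact fun h j _ hj => (hP ⟨j, hj⟩).2 (h ⟨j, hj⟩)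

end StackProg

namespace QV

open StackProg Function Computability

variable {w : List Γ'} {ρ : ℕ → ℕ}

/-! ### Sums over the symbols of a word -/

/-- The number of commas before position `10`. -/
def commasE : Expr :=
  .sum (fun a => a = .comma) false 13 (.cond (.lt (.var 13) (.var 10)) (.num 1) (.num 0))

theorem sum_commas (w : List Γ') (q s : ℕ) : ((w.zipIdx s).map fun y =>
    if y.1 = Γ'.comma then if y.2 < s + q then 1 else 0 else 0).sum = commas w q := by
  induction w generalizing q s with
  | nil => simp [commas]
  | cons a w ih =>
    rw [List.zipIdx_cons, List.map_cons, List.sum_cons]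
    rcases q with _ | q
    · rw [List.sum_eq_zero]
      · simp [commas]
      · intro y hy
        obtain ⟨x, hx, rfl⟩ := List.mem_map.1 hy
        have := List.le_snd_of_mem_zipIdx hx
        rw [if_neg (by omega : ¬ x.2 < s + 0), ite_self]
    · have := ih q (s + 1)
      rw [show s + 1 + q = s + (q + 1) by ring] at this
      rw [this, commas, commas, List.take_succ_cons, List.count_cons, add_comm]
      simp

@[simp] theorem eval_commasE : commasE.eval w ρ = commas w (ρ 10) := by
  rw [commasE, Expr.eval_sum_false, ← sum_commas w (ρ 10) 0]
  simp

/-- The number of positions before position `10` in the same token. -/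
def offsetE : Expr := .total 14 (.cond (.and (.lt (.var 14) (.var 10))
  (.eq (.sub 10 (.var 14) commasE) commasE)) (.num 1) (.num 0))

theorem eval_offsetE (h : ρ 10 ≤ w.length) : offsetE.eval w ρ = offset w (ρ 10) := by
  simp only [offsetE, Expr.eval_total, Expr.eval_cond, Expr.holds_and, Expr.holds_lt,
    Expr.eval_var, Expr.holds_eq, Expr.eval_sub, eval_commasE, Expr.eval_num, update_self,
    update_of_ne (show (10 : ℕ) ≠ 14 by decide)]
  rw [← Finset.card_filter, offset, ← List.toFinset_card_of_nodup (List.nodup_range.filter _)]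
  congr 1
  ext j
  simp
  omega

/-- The sum over the symbols in `s`, where variable `11` stands for the number of the token, and
variable `12` for the position in the token. -/
def wsumE (s : Γ' → Bool) (e : Expr) : Expr :=
  .sum s false 10 (.sub 11 commasE (.sub 12 offsetE e))

/-- A position in a token is at most a position in the word, so `p ≤ w.length` may be assumed; the
powers of two in `tokAbsE` need it. -/
theorem eval_wsumE {s : Γ' → Bool} {e : Expr} {F : Γ' → ℕ → ℕ → ℕ}
    (hF : ∀ a k p j, p ≤ w.length →
      F a k p = if s a then e.eval w (update (update (update ρ 10 j) 11 k) 12 p) else 0) :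
    (wsumE s e).eval w ρ = wsum w F := by
  rw [wsumE, Expr.eval_sum_false, wsum, ← map_zipIdx_eq_annotate, List.map_map]
  congr 1
  refine List.map_congr_left fun y hy => ?_
  have hy' : y.2 < w.length := by simpa using List.snd_lt_of_mem_zipIdx hy
  have ho : offset w y.2 ≤ y.2 := by
    refine (List.length_filter_le _ _).trans ?_
    rw [List.length_range]
  simp only [Expr.eval_sub, eval_commasE, Function.comp_apply, update_self]
  rw [eval_offsetE (by simpa using hy'.le), hF _ _ _ y.2 (by omega)]
  simp

/-! ### Tokens -/

/-- The number of symbols `bra` in token `20`. -/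
def numBraE : Expr := wsumE (fun a => a = .bra) (.cond (.eq (.var 11) (.var 20)) (.num 1) (.num 0))

@[simp] theorem eval_numBraE : numBraE.eval w ρ = numBra w (ρ 20) := by
  refine eval_wsumE fun a k p j _ => ?_
  simp; grind

/-- The number of tokens. -/
def numTokensE : Expr := wsumE (fun a => a = .comma) (.num 1)

@[simp] theorem eval_numTokensE : numTokensE.eval w ρ = numTokens w := by
  refine eval_wsumE fun a k p j _ => ?_
  simp

/-- The length of token `20`. -/
def tokLenE : Expr :=
  wsumE (fun a => a ≠ .comma) (.cond (.eq (.var 11) (.var 20)) (.num 1) (.num 0))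

@[simp] theorem eval_tokLenE : tokLenE.eval w ρ = tokLen w (ρ 20) := by
  refine eval_wsumE fun a k p j _ => ?_
  simp; grind

/-- The sign bit of token `20`. -/
def tokSignE : Expr := wsumE (fun a => a = .bit true)
  (.cond (.and (.eq (.var 11) (.var 20)) (.eq (.var 12) (.num 0))) (.num 1) (.num 0))

@[simp] theorem eval_tokSignE : tokSignE.eval w ρ = tokSign w (ρ 20) := by
  refine eval_wsumE fun a k p j _ => ?_
  simp; grind

/-- The absolute value of the integer that is encoded by token `20`. -/
def tokAbsE : Expr := wsumE (fun a => a = .bit true)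
  (.cond (.and (.eq (.var 11) (.var 20)) (.lt (.num 0) (.var 12))) (.pow 15 (.var 12)) (.num 0))

@[simp] theorem eval_tokAbsE : tokAbsE.eval w ρ = tokAbs w (ρ 20) := by
  refine eval_wsumE fun a k p j hp => ?_
  rcases Nat.eq_zero_or_pos p with rfl | h0
  · simp
  · rw [Expr.eval_cond, Expr.eval_pow (k := p) (by simp) h0 hp]
    simp [h0]; grind

/-- The last bit of token `20`. -/
def tokLastE : Expr := wsumE (fun a => a = .bit true)
  (.cond (.and (.eq (.var 11) (.var 20)) (.eq (.add (.var 12) (.num 1)) tokLenE)) (.num 1) (.num 0))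

@[simp] theorem eval_tokLastE : tokLastE.eval w ρ = tokLast w (ρ 20) := by
  refine eval_wsumE fun a k p j _ => ?_
  simp; grind

/-- The integer that is encoded by token `20`. -/
def tokIntE : ZExpr :=
  .cond (.lt (.num 0) tokSignE) (.sub (.ofNat (.num 0)) (.ofNat tokAbsE)) (.ofNat tokAbsE)

@[simp] theorem eval_tokIntE : tokIntE.eval w ρ = tokInt w (ρ 20) := by
  simp [tokIntE, tokInt]

/-- The number of agents. -/
def agentsE : Expr := .sub 20 (.num 0) numBraE

/-- The number of outcomes. -/
def outcomesE : Expr := .sub 20 (.num 1) numBraE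

/-- The word is the encoding of an instance. -/
def validE : Expr :=
  .and (.eq numTokensE (.add (.num 2) (.mul (.num 2) (.mul agentsE outcomesE)))) <|
  .and (.eq (wsumE (fun _ => true) (.cond (.lt (.var 11) numTokensE) (.num 0) (.num 1)))
    (.num 0)) <|
  .and (.eq (wsumE (fun a => a ∉ [Γ'.bra, .comma])
    (.cond (.le (.num 2) (.var 11)) (.num 0) (.num 1))) (.num 0)) <|
  .and (.eq (wsumE (fun a => a ∉ [Γ'.bit false, .bit true, .comma])
    (.cond (.lt (.var 11) (.num 2)) (.num 0) (.num 1))) (.num 0)) <|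
  .all 20 <| .imp (.le (.num 2) (.var 20)) <| .imp (.lt (.var 20) numTokensE) <|
    .and (.lt (.num 0) tokLenE) <|
    .and (.imp (.lt (.num 0) tokLastE) (.lt (.num 1) tokLenE))
      (.imp (.lt (.num 1) tokLenE) (.lt (.num 0) tokLastE))

theorem holds_validE : validE.Holds w ρ ↔ Valid w := by
  have e1 : (wsumE (fun _ => true) (.cond (.lt (.var 11) numTokensE) (.num 0) (.num 1))).eval w ρ
      = wsum w (fun _ k _ => if k < numTokens w then 0 else 1) :=
    eval_wsumE fun a k p j _ => by simp
  have e2 : (wsumE (fun a => a ∉ [Γ'.bra, .comma])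
      (.cond (.le (.num 2) (.var 11)) (.num 0) (.num 1))).eval w ρ
      = wsum w (fun a k _ => if a ∈ [Γ'.bra, .comma] ∨ 2 ≤ k then 0 else 1) :=
    eval_wsumE fun a k p j _ => by simp; grind
  have e3 : (wsumE (fun a => a ∉ [Γ'.bit false, .bit true, .comma])
      (.cond (.lt (.var 11) (.num 2)) (.num 0) (.num 1))).eval w ρ
      = wsum w (fun a k _ => if a ∈ [Γ'.bit false, .bit true, .comma] ∨ k < 2 then 0 else 1) :=
    eval_wsumE fun a k p j _ => by simp; grind
  simp only [validE, Expr.holds_and, Expr.holds_eq, e1, e2, e3, Valid, Expr.holds_all,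
    Expr.holds_imp, Expr.holds_le, Expr.holds_lt, agentsE, outcomesE, Expr.eval_sub,
    eval_numBraE, eval_numTokensE, eval_tokLenE, eval_tokLastE, Expr.eval_num, Expr.eval_var,
    Expr.eval_add, Expr.eval_mul, update_self, iff_def]

end QV

/-! ## The formula for equilibria -/

namespace QV

open StackProg Function Computability

/-- The agents, outcomes, and numbers `t`, `k`, `φ` are denoted by the variables `0`, `1`, `3`, `4`
and `5`; the utility of agent `0` for outcome `1`. -/
def utilityE : ZExpr :=
  .subst 20 (.add (.num 2) (.add (.mul outcomesE (.var 0)) (.var 1))) tokIntE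

/-- The votes of agent `0` for outcome `1`. -/
def voteE : ZExpr := .subst 20 (.add (.num 2) (.add (.mul agentsE outcomesE)
  (.add (.mul outcomesE (.var 0)) (.var 1)))) tokIntE

/-- The total votes for outcome `1`. -/
def totalE : ZExpr := .bsum 0 agentsE voteE

/-- The total votes for outcome `1` of the agents other than `0`. -/
def othersE : ZExpr := .sub totalE voteE

/-- The bound for the votes of the other agents. -/
def boundE : ZExpr := .ofNat (.add (.mul (.num 2) agentsE) (.num 1))

/-- The number of votes of the winners. -/
def thresholdE : ZExpr := .sub (.ofNat (.var 3)) boundE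

/-- The number one. -/
def one : ZExpr := .ofNat (.num 1)

/-- The cheapest votes of agent `0` that keep outcome `1` below the threshold. -/
def lowVoteE : ZExpr :=
  .cond (ZExpr.le (.ofNat (.num 0)) (.sub (.sub thresholdE one) othersE)) (.ofNat (.num 0))
    (.sub (.sub thresholdE one) othersE)

/-- The square of a number. -/
def sq (e : ZExpr) : ZExpr := .mul e e

/-- The price of including outcome `1` in the set of winners. -/
def extraCostE : ZExpr := .sub (sq (.sub thresholdE othersE)) (sq lowVoteE)

/-- The value of outcome `1` as one of `k` winners. -/
def winValueE (p q : ℕ) : ZExpr :=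
  .sub (.mul (.ofNat (.num q)) utilityE)
    (.mul (.mul (.ofNat (.num p)) (.ofNat (.var 4))) extraCostE)

/-- The key that orders the outcomes by their values. -/
def lexKeyE (p q : ℕ) : ZExpr :=
  .add (.mul (.ofNat outcomesE) (winValueE p q)) (.ofNat (.var 1))

/-- Outcome `1` is one of the best outcomes. -/
def bestE (p q : ℕ) : Expr := ZExpr.le (.subst 1 (.var 5) (lexKeyE p q)) (lexKeyE p q)

/-- Outcome `1` is a possible winner. -/
def winnerE : Expr := .ball 2 outcomesE (ZExpr.le (.subst 1 (.var 2) totalE) totalE)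

/-- The votes for outcome `1` in the deviation of agent `0`. -/
def devE (p q : ℕ) : ZExpr := .cond (bestE p q) (.sub thresholdE othersE) lowVoteE

/-- The sum of `e` over all outcomes in a set. -/
def sumOver (c : Expr) (e : ZExpr) : ZExpr := .bsum 1 outcomesE (.cond c e (.ofNat (.num 0)))

/-- The deviation of agent `0` is not profitable. -/
def compareE (p q : ℕ) : Expr :=
  let U := sumOver (bestE p q) one
  let W := sumOver winnerE one
  let P : ZExpr := .mul (.mul (.ofNat (.num p)) U) W
  ZExpr.le (.add (.mul (.mul (.ofNat (.num q)) W) (sumOver (bestE p q) utilityE))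
      (.mul P (.bsum 1 outcomesE (sq voteE))))
    (.add (.mul (.mul (.ofNat (.num q)) U) (sumOver winnerE utilityE))
      (.mul P (.bsum 1 outcomesE (sq (devE p q)))))

/-- The strategy profile is an equilibrium. -/
def nashE (p q : ℕ) : Expr :=
  .ball 0 agentsE <| .and
    -- Explicit rejection of profiles with large votes, for which the thresholds below would not be
    -- exhaustive.
    (.ball 1 outcomesE (.and (ZExpr.le othersE boundE)
      (ZExpr.le (.sub (.ofNat (.num 0)) boundE) othersE))) <|
    -- Quantifying over `φ` first guarantees an outcome in the scope of the other quantifiers, which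
    -- makes the word long enough for the `4 * n + 4` thresholds.
    .ball 5 outcomesE <|
      .ball 3 (.add (.mul (.num 4) agentsE) (.num 4)) <|
        .ball 4 (.add outcomesE (.num 1)) <| compareE p q

/-! ### Evaluation of the formula on encoded instances -/

section

variable {I : Instance} {ρ : ℕ → ℕ} {i : Fin I.n} {ω φ : Fin I.m} {k : ℕ} {t : ℤ} {p q : ℕ}

@[simp] theorem eval_agentsE : agentsE.eval I.encode ρ = I.n := by
  simp [agentsE, I.numBra_zero]

@[simp] theorem eval_outcomesE : outcomesE.eval I.encode ρ = I.m := by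
  simp [outcomesE, I.numBra_one]

theorem Instance.n_le (I : Instance) : I.n ≤ I.encode.length := by
  have := I.length_encode_ge; omega

theorem Instance.m_le (I : Instance) : I.m ≤ I.encode.length := by
  have := I.length_encode_ge; omega

theorem eval_utilityE (h0 : ρ 0 = i) (h1 : ρ 1 = ω) : utilityE.eval I.encode ρ = I.u i ω := by
  simp [utilityE, h0, h1, I.tokInt_u]

theorem eval_voteE (h0 : ρ 0 = i) (h1 : ρ 1 = ω) : voteE.eval I.encode ρ = I.v i ω := by
  simp [voteE, h0, h1, I.tokInt_v]

theorem eval_totalE (h1 : ρ 1 = ω) : totalE.eval I.encode ρ = totalVotes I.v ω :=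
  ZExpr.eval_bsum (by simp) I.n_le fun j => eval_voteE (by simp) (by simp [h1])

theorem eval_othersE (h0 : ρ 0 = i) (h1 : ρ 1 = ω) :
    othersE.eval I.encode ρ = others I.v i ω := by
  rw [othersE, ZExpr.eval_sub, eval_totalE h1, eval_voteE h0 h1, others]

theorem eval_boundE : boundE.eval I.encode ρ = 2 * I.n + 1 := by simp [boundE]

theorem eval_one : one.eval I.encode ρ = 1 := by simp [one]

theorem eval_sq (e : ZExpr) : (sq e).eval I.encode ρ = e.eval I.encode ρ ^ 2 := by
  simp [sq, pow_two]

theorem eval_thresholdE : thresholdE.eval I.encode ρ = ρ 3 - (2 * I.n + 1) := by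
  simp [thresholdE, eval_boundE]

theorem eval_lowVoteE (h0 : ρ 0 = i) (h1 : ρ 1 = ω) (h3 : ρ 3 - (2 * I.n + 1) = t) :
    lowVoteE.eval I.encode ρ = lowVote (others I.v i) t ω := by
  simp only [lowVoteE, ZExpr.eval_cond, ZExpr.holds_le, ZExpr.eval_ofNat, ZExpr.eval_sub,
    eval_thresholdE, h3, eval_one, eval_othersE h0 h1, Expr.eval_num, lowVote, min_def,
    Nat.cast_zero]

theorem eval_extraCostE (h0 : ρ 0 = i) (h1 : ρ 1 = ω) (h3 : ρ 3 - (2 * I.n + 1) = t) :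
    extraCostE.eval I.encode ρ = extraCost (others I.v i) t ω := by
  rw [extraCostE, ZExpr.eval_sub, eval_sq, eval_sq, ZExpr.eval_sub, eval_lowVoteE h0 h1 h3,
    eval_othersE h0 h1, eval_thresholdE, h3, extraCost]

theorem eval_lexKeyE (h0 : ρ 0 = i) (h1 : ρ 1 = ω) (h3 : ρ 3 - (2 * I.n + 1) = t)
    (h4 : ρ 4 = k) : (lexKeyE p q).eval I.encode ρ
      = lexKey (winValue p q (I.u i) (others I.v i) t k) ω := by
  simp [lexKeyE, winValueE, eval_extraCostE h0 h1 h3, eval_utilityE h0 h1, h1, h4, lexKey, winValue]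

theorem holds_bestE (h0 : ρ 0 = i) (h1 : ρ 1 = ω) (h3 : ρ 3 - (2 * I.n + 1) = t)
    (h4 : ρ 4 = k) (h5 : ρ 5 = φ) : (bestE p q).Holds I.encode ρ
      ↔ ω ∈ bestSet p q (I.u i) (others I.v i) t k φ := by
  rw [bestE, ZExpr.holds_le, ZExpr.eval_subst, eval_lexKeyE h0 h1 h3 h4,
    eval_lexKeyE (ω := φ) (t := t) (k := k) (i := i) (by simp [h0]) (by simp [h5]) (by simp [h3])
      (by simp [h4])]
  simp [bestSet, upper]

theorem holds_winnerE (h1 : ρ 1 = ω) :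
    winnerE.Holds I.encode ρ ↔ ω ∈ argmax (totalVotes I.v) := by
  simp only [argmax, Finset.mem_filter, Finset.mem_univ, true_and]
  refine Expr.holds_ball (by simp) I.m_le fun ψ => ?_
  rw [ZExpr.holds_le, ZExpr.eval_subst, eval_totalE (ω := ψ) (by simp),
    eval_totalE (ω := ω) (by simp [h1])]

theorem eval_devE (h0 : ρ 0 = i) (h1 : ρ 1 = ω) (h3 : ρ 3 - (2 * I.n + 1) = t)
    (h4 : ρ 4 = k) (h5 : ρ 5 = φ) : (devE p q).eval I.encode ρ
      = dev (others I.v i) t (bestSet p q (I.u i) (others I.v i) t k φ) ω := by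
  simp only [devE, ZExpr.eval_cond, holds_bestE h0 h1 h3 h4 h5, ZExpr.eval_sub,
    eval_lowVoteE h0 h1 h3, eval_othersE h0 h1, eval_thresholdE, h3, dev]

theorem eval_sumOver {c : Expr} {e : ZExpr} {W : Finset (Fin I.m)} {f : Fin I.m → ℤ}
    (hc : ∀ ω : Fin I.m, c.Holds I.encode (update ρ 1 ω) ↔ ω ∈ W)
    (he : ∀ ω : Fin I.m, e.eval I.encode (update ρ 1 ω) = f ω) :
    (sumOver c e).eval I.encode ρ = ∑ ω ∈ W, f ω := by
  rw [sumOver, ZExpr.eval_bsum (by simp) I.m_le (f := fun ω => if ω ∈ W then f ω else 0),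
    Finset.sum_ite_mem, Finset.univ_inter]
  intro ω
  simp [hc, he]

/-- Multiplying by `q * |U| * |W|` and moving the costs to the opposite sides leaves an integer
inequality. -/
theorem payoff_le_payoff_iff {m : ℕ} (hq : 0 < q) (u : Fin m → ℤ) {U W : Finset (Fin m)}
    (hU : U.Nonempty) (hW : W.Nonempty) (c d : ℤ) :
    payoff (p / q : ℝ) u U d ≤ payoff (p / q : ℝ) u W c ↔
      q * W.card * ∑ ω ∈ U, u ω + p * U.card * W.card * c
        ≤ q * U.card * ∑ ω ∈ W, u ω + p * U.card * W.card * d := by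
  have hq' : (0 : ℝ) < q := by exact_mod_cast hq
  have hU' : (0 : ℝ) < U.card := by exact_mod_cast Finset.card_pos.2 hU
  have hW' : (0 : ℝ) < W.card := by exact_mod_cast Finset.card_pos.2 hW
  rw [← @Int.cast_le ℝ]
  push_cast
  rw [payoff, payoff, ← mul_le_mul_iff_right₀ (show (0 : ℝ) < q * U.card * W.card by positivity)]
  have e1 : (q * U.card * W.card : ℝ) * ((∑ ω ∈ U, (u ω : ℝ)) / U.card - p / q * d)
      = q * W.card * ∑ ω ∈ U, (u ω : ℝ) - p * U.card * W.card * d := by field_simp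
  have e2 : (q * U.card * W.card : ℝ) * ((∑ ω ∈ W, (u ω : ℝ)) / W.card - p / q * c)
      = q * U.card * ∑ ω ∈ W, (u ω : ℝ) - p * U.card * W.card * c := by field_simp
  rw [e1, e2]
  constructor <;> intro h <;> linarith

theorem holds_compareE (hq : 0 < q) (h0 : ρ 0 = i) (h3 : ρ 3 - (2 * I.n + 1) = t) (h4 : ρ 4 = k)
    (h5 : ρ 5 = φ) : (compareE p q).Holds I.encode ρ ↔
      payoff (p / q : ℝ) (I.u i) (bestSet p q (I.u i) (others I.v i) t k φ)
        (cost (dev (others I.v i) t (bestSet p q (I.u i) (others I.v i) t k φ))) ≤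
      payoff (p / q : ℝ) (I.u i) (argmax (others I.v i + I.v i)) (cost (I.v i)) := by
  rw [others_add_self, payoff_le_payoff_iff hq _ (U := bestSet ..) (upper_nonempty _ _)
    (exists_argmax φ _).1]
  set U := bestSet p q (I.u i) (others I.v i) t k φ
  set W := argmax (totalVotes I.v)
  have r0 : ∀ ω : Fin I.m, update ρ 1 ω 0 = i := by simp [h0]
  have r1 : ∀ ω : Fin I.m, update ρ 1 ω 1 = ω := by simp
  have hU : ∀ ω : Fin I.m, (bestE p q).Holds I.encode (update ρ 1 ω) ↔ ω ∈ U := fun ω =>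
    holds_bestE (r0 ω) (r1 ω) (by simpa using h3) (by simpa using h4) (by simpa using h5)
  have hW : ∀ ω : Fin I.m, winnerE.Holds I.encode (update ρ 1 ω) ↔ ω ∈ W := fun ω =>
    holds_winnerE (r1 ω)
  have hu := fun ω => eval_utilityE (r0 ω) (r1 ω)
  have e1 := eval_sumOver hU (e := one) (f := fun _ => 1) fun _ => eval_one
  have e2 := eval_sumOver hW (e := one) (f := fun _ => 1) fun _ => eval_one
  have e3 : (ZExpr.bsum 1 outcomesE (sq voteE)).eval I.encode ρ = cost (I.v i) :=
    ZExpr.eval_bsum (by simp) I.m_le fun ω => by rw [eval_sq, eval_voteE (r0 ω) (r1 ω)]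
  have e4 : (ZExpr.bsum 1 outcomesE (sq (devE p q))).eval I.encode ρ
      = cost (dev (others I.v i) t U) :=
    ZExpr.eval_bsum (by simp) I.m_le fun ω => by
      rw [eval_sq, eval_devE (r0 ω) (r1 ω) (by simpa using h3) (by simpa using h4)
        (by simpa using h5)]
  simp only [compareE, ZExpr.holds_le, ZExpr.eval_add, ZExpr.eval_mul, ZExpr.eval_ofNat,
    Expr.eval_num, e1, e2, e3, e4, eval_sumOver hU hu, eval_sumOver hW hu, Finset.sum_const,
    nsmul_eq_mul, mul_one]

/-- If the bound on the other agents' votes holds, the finite test is exact by `isBest_iff`; if it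
fails, there is no equilibrium by `abs_others_le`. -/
theorem holds_nashE (hp : 0 < p) (hq : 0 < q) : (nashE p q).Holds I.encode ρ ↔
    IsPureNash (p / q : ℝ) (fun i ω => (I.u i ω : ℝ)) I.v := by
  rw [isPureNash_iff]
  set S := others I.v
  have key : (nashE p q).Holds I.encode ρ ↔ ∀ i, (∀ ω, S i ω ≤ 2 * I.n + 1 ∧
      0 - (2 * I.n + 1) ≤ S i ω) ∧ ∀ φ : Fin I.m, ∀ j : Fin (4 * I.n + 4), ∀ k : Fin (I.m + 1),
      payoff (p / q : ℝ) (I.u i) (bestSet p q (I.u i) (S i) (j - (2 * I.n + 1)) k φ)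
        (cost (dev (S i) (j - (2 * I.n + 1))
          (bestSet p q (I.u i) (S i) (j - (2 * I.n + 1)) k φ))) ≤
      payoff (p / q : ℝ) (I.u i) (argmax (S i + I.v i)) (cost (I.v i)) := by
    refine Expr.holds_ball (by simp) I.n_le fun i => ?_
    rw [Expr.holds_and]
    refine and_congr (Expr.holds_ball (by simp) I.m_le fun ω => ?_)
      (Expr.holds_ball (by simp) I.m_le fun φ => ?_)
    · rw [Expr.holds_and, ZExpr.holds_le, ZExpr.holds_le, ZExpr.eval_sub, eval_boundE,
        eval_othersE (i := i) (ω := ω) (by simp) (by simp)]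
      simp [S]
    · have hlen := I.length_encode_ge
      have hi := i.pos
      have hφ := φ.pos
      have hnm : I.n ≤ I.n * I.m := Nat.le_mul_of_pos_right _ hφ
      have hnm1 : I.n + I.m ≤ I.n * I.m + 1 := by nlinarith
      refine Expr.holds_ball (by simp) (by omega) fun j => ?_
      refine Expr.holds_ball (by simp) (by omega) fun k => ?_
      exact holds_compareE hq (by simp) (by simp) (by simp) (by simp)
  rw [key]
  have hα : (0 : ℝ) < p / q := by positivity
  constructor
  · intro h i
    have hS : ∀ ω, |S i ω| ≤ 2 * I.n + 1 := fun ω => by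
      have := (h i).1 ω
      rw [abs_le]; omega
    rw [isBest_iff hq (by positivity) hS]
    intro t h1 h2 k hk φ
    -- The index `j = t + (2 * n + 1)` runs from `0` to `4 * n + 3` as `t` runs from `-B` to `B +
    -- 1`, with `B = 2 * n + 1`.
    have := (h i).2 φ ⟨(t + (2 * I.n + 1)).toNat, by omega⟩ ⟨k, by omega⟩
    have e : (((t + (2 * I.n + 1)).toNat : ℕ) : ℤ) - (2 * I.n + 1) = t := by omega
    simpa only [e] using this
  · intro h i
    have hS : ∀ ω, |S i ω| ≤ 2 * I.n + 1 := fun ω => abs_others_le hα h i ω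
    refine ⟨fun ω => ?_, fun φ j k => ?_⟩
    · have := abs_le.1 (hS ω)
      omega
    · have := j.2
      exact (isBest_iff hq (by positivity) hS).1 (h i) _ (by omega) (by omega) k (by omega) φ

end

end QV

/-! ### Membership in P -/

theorem mainTheorem2 (α : ℚ) (hα : 0 < α) : InP (QV.QVNE (α : ℝ)) := by
  have hα' : (α : ℝ) = (α.num.toNat : ℝ) / (α.den : ℝ) := by
    have : ((α.num.toNat : ℤ) : ℝ) = (α.num : ℝ) := by
      rw [Int.toNat_of_nonneg (Rat.num_pos.2 hα).le]
    rw [← Int.cast_natCast, this, ← Rat.cast_def]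
  have hp : 0 < α.num.toNat := by have := Rat.num_pos.2 hα; omega
  refine StackProg.inP_of_expr (.and QV.validE (QV.nashE α.num.toNat α.den)) fun w => ?_
  change StackProg.Expr.Holds w 0 _ ↔ _
  rw [StackProg.Expr.holds_and, QV.holds_validE, QV.valid_iff, hα']
  constructor
  · rintro ⟨⟨I, rfl⟩, h⟩
    exact ⟨I, rfl, (QV.holds_nashE hp α.pos).1 h⟩
  · rintro ⟨I, rfl, h⟩
    exact ⟨⟨I, rfl⟩, (QV.holds_nashE hp α.pos).2 h⟩
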